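/- **Conventions.** Let $p$ be a prime. Composition and conjugation are written from left to right, $x^g=g^{-1}xg$. A *partial group* is a set $\mathcal L$ with an involution $g\mapsto g^{-1}$, a set $\mathbf D$ of words in $\mathcal L$ containing all words of length one and closed under subwords of consecutive letters, and a product $\Pi:\mathbf D\to\mathcal L$ with $\Pi(g)=g$, such that $u\circ v\circ w\in\mathbf D$ implies $u\circ\Pi(v)\circ w\in\mathbf D$ with the same product, and such that $w\in\mathbf D$ implies $w^{-1}\circ w\in\mathbf D$ with product $\mathbf 1=\Pi(\emptyset)$. A *subgroup* is a subset closed under inversion and products, all of whose words lie in $\mathbf D$. For $g\in\mathcal L$, $x^g=\Pi(g^{-1},x,g)$ is defined if $(g^{-1},x,g)\in\mathbf D$. A *locality* $(\mathcal L,\Delta,S)$ consists of a partial group $\mathcal L$, a $p$-subgroup $S$ of $\mathcal L$ that is maximal among the $p$-subgroups of $\mathcal L$, and a set $\Delta$ of subgroups of $S$ with $S\in\Delta$, such that: a word $(g_1,\dots,g_n)$ is in $\mathbf D$ if and only if there are $P_0,\dots,P_n\in\Delta$ with $P_{i-1}^{g_i}=P_i$ for all $i$; every subgroup of $S$ containing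 a conjugate $X^g$ ($g\in\mathcal L$) of some $X\in\Delta$ is in $\Delta$; and the poset of all intersections of non-empty families of sets $S_w$ has bounded chain lengths, where for a word $w$, $S_w$ is the set of all $x\in S$ that are conjugated successively into $S$ by the letters of $w$. For $P,Q\in\Delta$ let $N_{\mathcal L}(P,Q)$ be the set of all $g\in\mathcal L$ such that $x^g$ is defined and lies in $Q$ for all $x\in P$, and for $g$ in this set let $c_g:P\to Q$ be the homomorphism $x\mapsto x^g$. Put $N_{\mathcal L}(P)=\{g\mid P^g=P\}$ (a subgroup), $C_{\mathcal L}(P)=\{g\mid x^g=x\ \forall x\in P\}$, $N_S(P,Q)=\{s\in S\mid P^s\le Q\}$, $N_S(P)=\{s\in S\mid P^s=P\}$. The *fusion system of* $\mathcal L$ is the fusion system $\mathcal F=\mathcal F_S(\mathcal L)$ on $S$ generated by all $c_g:P\to Q$ with $P,Q\in\Delta$ and $g\in N_{\mathcal L}(P,Q)$, and $\mathcal L$ is then said to be *on* $\mathcal F$. A group is *virtually $p$-toral* if it has a subgroup of finite index isomorphic to a finite direct power of the Prüfer group $\mathbb Z(p^\infty)$. The locality is *compact* if: every $P\le S$ with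 $C_S(Q)\le Q$ for all $\mathcal F$-conjugates $Q$ of $P$ and with $O_p(\mathrm{Out}_{\mathcal F}(P))=1$ is in $\Delta$; for every $P\in\Delta$ the group $G=N_{\mathcal L}(P)$ is virtually $p$-toral and satisfies $C_G(O_p(G))\le O_p(G)$; and $X<N_Y(X)$ for all subgroups $X<Y$ of $S$. Let $\mathcal T=\mathcal T_\Delta(\mathcal L)$ be the category with object set $\Delta$ and $\mathrm{Mor}_{\mathcal T}(P,Q)=N_{\mathcal L}(P,Q)$, with composition $(g:P\to Q)\circ(h:Q\to R)=\Pi(g,h)$, and let $\mathcal T_\Delta(S)$ be the category with object set $\Delta$ and morphism sets $N_S(P,Q)$. Let $\epsilon:\mathcal T_\Delta(S)\to\mathcal T$ be the functor that is the identity on objects and is given on morphisms by the inclusions $\epsilon_{P,Q}:N_S(P,Q)\to N_{\mathcal L}(P,Q)$, and let $\rho:\mathcal T\to\mathcal F$ be the functor that is the inclusion on objects and sends $g$ to $c_g$. Write $\epsilon_P=\epsilon_{P,P}$, $\rho_P=\rho_{P,P}:\mathrm{Aut}_{\mathcal T}(P)\to\mathrm{Aut}_{\mathcal F}(P)$, and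 $\iota_{P,Q}=(\mathbf 1)\epsilon_{P,Q}$ for $P\le Q$ in $\Delta$. **Proposition.** Let $(\mathcal L,\Delta,S)$ be a compact locality on $\mathcal F$. For every $P\in\Delta$, every $\mathcal T$-endomorphism of $P$ is an automorphism, $g\mapsto(g:P\to P)$ is an isomorphism $N_{\mathcal L}(P)\to\mathrm{Aut}_{\mathcal T}(P)$, and it maps $C_{\mathcal L}(P)$ onto $\mathrm{Ker}(\rho_P)$. Moreover: * (A1) $\epsilon$ is the identity on objects and $\rho$ is the inclusion on objects. * (A2) For all $P,Q\in\Delta$ the group $\mathrm{Ker}(\rho_P)$ acts freely on $\mathrm{Mor}_{\mathcal T}(P,Q)$ from the left by composition, and $\rho_{P,Q}:\mathrm{Mor}_{\mathcal T}(P,Q)\to\mathrm{Hom}_{\mathcal F}(P,Q)$ is the orbit map for this action (it is surjective and its fibres are the orbits). Also, $\mathrm{Ker}(\rho_Q)$ acts freely on $\mathrm{Mor}_{\mathcal T}(P,Q)$ from the right. * (B) For all $P,Q\in\Delta$ the map $\epsilon_{P,Q}$ is injective, and $\epsilon_{P,Q}\circ\rho_{P,Q}$ sends $s\in N_S(P,Q)$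 to $c_s\in\mathrm{Hom}_{\mathcal F}(P,Q)$. * (C) For all $\phi\in\mathrm{Mor}_{\mathcal T}(P,Q)$ and all $x\in P$, with $y\in Q$ the image of $x$ under $\rho(\phi)$, we have $(x)\epsilon_P\circ\phi=\phi\circ(y)\epsilon_Q$. * (I) Each $\mathcal F$-conjugacy class of subgroups in $\Delta$ contains a subgroup $P$ such that the image of $N_S(P)$ under $\epsilon_P$ is a Sylow $p$-subgroup of $\mathrm{Aut}_{\mathcal T}(P)$, i.e. a $p$-subgroup of finite index relatively prime to $p$. * (II) Let $\phi:P\to Q$ be a $\mathcal T$-isomorphism, let $P\trianglelefteq\bar P\le S$ and $Q\trianglelefteq\bar Q\le S$, and suppose that the map $c_\phi:\mathrm{Aut}_{\mathcal T}(P)\to\mathrm{Aut}_{\mathcal T}(Q)$, $\alpha\mapsto\phi^{-1}\circ\alpha\circ\phi$, sends $(\bar P)\epsilon_P$ into $(\bar Q)\epsilon_Q$. Then $\bar P,\bar Q\in\Delta$ and there is $\bar\phi\in\mathrm{Mor}_{\mathcal T}(\bar P,\bar Q)$ with $\iota_{P,\bar P}\circ\bar\phi=\phi\circ\iota_{Q,\bar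 Q}$. * (III) Let $P_1\le P_2\le\cdots$ be an increasing sequence of members of $\Delta$, and for each $i$ let $\psi_i\in\mathrm{Mor}_{\mathcal T}(P_i,S)$ be such that $\psi_i=\iota_{P_i,P_{i+1}}\circ\psi_{i+1}$ for all $i$. Put $P=\bigcup_iP_i$. Then $P\in\Delta$ and there is $\psi\in\mathrm{Mor}_{\mathcal T}(P,S)$ with $\psi_i=\iota_{P_i,P}\circ\psi$ for all $i$. -/

import Mathlib

universe u

/-! ### Partial groups -/

/-- A partial group: a set `L` with an involutory bijection `g ↦ g⁻¹`, a set `D` of words in the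
alphabet `L`, and a product `D → L`. The product is given as a function on all words; its values
outside `D` carry no meaning and are never used. -/
class PartialGroup (L : Type u) extends Inv L where
  D : Set (List L)
  prod : List L → L
  single_mem : ∀ g : L, [g] ∈ D
  left_mem : ∀ v w : List L, v ++ w ∈ D → v ∈ D
  right_mem : ∀ v w : List L, v ++ w ∈ D → w ∈ D
  prod_single : ∀ g : L, prod [g] = g
  contract_mem : ∀ v w z : List L, v ++ w ++ z ∈ D → v ++ [prod w] ++ z ∈ D
  contract_prod : ∀ v w z : List L, v ++ w ++ z ∈ D → prod (v ++ w ++ z) = prod (v ++ [prod w] ++ z)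
  invol : ∀ g : L, (g⁻¹)⁻¹ = g
  inv_mem : ∀ w : List L, w ∈ D → (w.map (fun g => g⁻¹)).reverse ++ w ∈ D
  inv_prod : ∀ w : List L, w ∈ D → prod ((w.map (fun g => g⁻¹)).reverse ++ w) = prod []

namespace PartialGroup

variable {L : Type u} [PartialGroup L]

/-- The identity element, i.e. the product of the empty word. -/
def unit : L := prod ([] : List L)

/-- `ConjTo g x y` says that `x` lies in the domain `D(g)` of conjugation by `g`, i.e.
`(g⁻¹, x, g) ∈ D`, and that `x ^ g = Π (g⁻¹, x, g)` is equal to `y`. -/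
def ConjTo (g x y : L) : Prop := [g⁻¹, x, g] ∈ (D : Set (List L)) ∧ prod [g⁻¹, x, g] = y

/-- The word `u` is in the domain, and `v` is in the domain with the same product. -/
def Same (v w : List L) : Prop := v ∈ (D : Set (List L)) → w ∈ (D : Set (List L)) ∧ prod v = prod w

theorem nil_mem : ([] : List L) ∈ (D : Set (List L)) :=
  left_mem [] [prod ([] : List L)] (single_mem _)

theorem same_contract (v w z : List L) : Same (v ++ w ++ z) (v ++ [prod w] ++ z) :=
  fun h => ⟨contract_mem v w z h, contract_prod v w z h⟩

theorem Same.trans {v w z : List L} (h : Same v w) (k : Same w z) : Same v z := fun hv =>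
  ⟨(k (h hv).1).1, (h hv).2.trans (k (h hv).1).2⟩

theorem prod_unit_right (a : L) : prod [a, unit] = a := by
  have h := contract_prod [a] [] [] (by simpa using single_mem a)
  simpa [prod_single, unit] using h.symm

theorem prod_unit_left (a : L) : prod [unit, a] = a := by
  have h := contract_prod [] [] [a] (by simpa using single_mem a)
  simpa [prod_single, unit] using h.symm

theorem same_unit (v z : List L) : Same (v ++ [unit] ++ z) (v ++ z) := by
  rcases List.eq_nil_or_concat v with rfl | ⟨v, a, rfl⟩
  · cases z with
    | nil => intro _; exact ⟨nil_mem, by simpa [unit] using prod_single (unit : L)⟩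
    | cons a z =>
      have h := same_contract [] [unit, a] z
      simpa [prod_unit_left] using h
  · have h := same_contract v [a, unit] z
    simpa [prod_unit_right] using h

theorem mul_inv_unit (g : L) : prod [g, g⁻¹] = unit := by
  have h := inv_prod [g⁻¹] (single_mem _)
  simpa [invol, unit] using h

theorem inv_mul_unit (g : L) : prod [g⁻¹, g] = unit := by
  have h := inv_prod [g] (single_mem _)
  simpa [unit] using h

theorem same_cancel (v : List L) (g : L) (z : List L) : Same (v ++ [g, g⁻¹] ++ z) (v ++ z) := by
  have h := same_contract v [g, g⁻¹] z
  rw [mul_inv_unit] at h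
  exact h.trans (same_unit v z)

theorem same_cancel_inv (v : List L) (g : L) (z : List L) : Same (v ++ [g⁻¹, g] ++ z) (v ++ z) := by
  have h := same_contract v [g⁻¹, g] z
  rw [inv_mul_unit] at h
  exact h.trans (same_unit v z)

/-- The formal inverse of a word. -/
def winv (w : List L) : List L := (w.map (fun g => g⁻¹)).reverse

theorem winv_winv (w : List L) : winv (winv w) = w := by
  have : ((fun g : L => g⁻¹) ∘ fun g => g⁻¹) = id := by funext g; exact invol g
  simp [winv, List.map_reverse, List.map_map, this]

theorem winv_mem {w : List L} (h : w ∈ (D : Set (List L))) : winv w ∈ (D : Set (List L)) :=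
  left_mem _ w (inv_mem w h)

theorem winv_append_mem {w : List L} (h : w ∈ (D : Set (List L))) :
    winv w ++ w ∈ (D : Set (List L)) := inv_mem w h

theorem append_winv_mem {w : List L} (h : w ∈ (D : Set (List L))) :
    w ++ winv w ∈ (D : Set (List L)) := by
  have := inv_mem _ (winv_mem h)
  rwa [← winv, winv_winv] at this

theorem eq_inv_of_mul {a g : L} (h : [a, g] ∈ (D : Set (List L))) (e : prod [a, g] = unit) :
    a = g⁻¹ := by
  have h1 : [a, g, g⁻¹, a⁻¹] ∈ (D : Set (List L)) := by
    simpa [winv] using append_winv_mem h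
  have h2 : [a, g, g⁻¹] ∈ (D : Set (List L)) := left_mem [a, g, g⁻¹] [a⁻¹] (by simpa using h1)
  have h3 := (same_cancel [a] g [] (by simpa using h2)).2
  have h4 := (same_contract [] [a, g] [g⁻¹] (by simpa using h2)).2
  rw [e] at h4
  simp only [List.nil_append, List.append_nil, List.cons_append, prod_unit_left, prod_single]
    at h3 h4
  rw [← h3, h4]

theorem prod_winv {w : List L} (h : w ∈ (D : Set (List L))) : prod (winv w) = (prod w)⁻¹ := by
  have h0 := winv_append_mem h
  have h1 := same_contract (winv w) w [] (by simpa using h0)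
  have h2 := same_contract [] (winv w) [prod w] (by simpa using h1.1)
  refine eq_inv_of_mul (by simpa using h2.1) ?_
  have h3 : prod (winv w ++ w) = unit := inv_prod w h
  have h4 := h1.2.trans (by simpa using h2.2)
  simpa using h4.symm.trans (by simpa using h3)

theorem unit_inv : (unit : L)⁻¹ = unit := by
  have := prod_winv (w := ([] : List L)) nil_mem
  simpa [winv, unit] using this.symm

theorem ConjTo.symm {g x y : L} (h : ConjTo g x y) : ConjTo g⁻¹ y x := by
  obtain ⟨h, rfl⟩ := h
  have h1 : [g, g⁻¹, x, g] ∈ (D : Set (List L)) := by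
    refine right_mem [g⁻¹, x⁻¹] _ ?_
    simpa [winv, invol] using winv_append_mem h
  have h2 : [g, g⁻¹, x, g, g⁻¹] ∈ (D : Set (List L)) := by
    refine left_mem _ [x⁻¹, g, g⁻¹] ?_
    simpa [winv, invol] using append_winv_mem h1
  have h3 := same_contract [g] [g⁻¹, x, g] [g⁻¹] (by simpa using h2)
  have h4 := same_cancel [] g [x, g, g⁻¹] (by simpa using h2)
  have h5 := same_cancel [x] g [] (by simpa using h4.1)
  refine ⟨by simpa [invol] using h3.1, ?_⟩
  have e3 := h3.2
  have e4 := h4.2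
  have e5 := h5.2
  simp only [List.nil_append, List.append_nil, List.cons_append, prod_single] at e3 e4 e5
  rw [invol, ← e3, e4, e5]

theorem ConjTo.eq {g x y z : L} (h : ConjTo g x y) (k : ConjTo g x z) : y = z :=
  h.2.symm.trans k.2

theorem ConjTo.inj {g x z y : L} (h : ConjTo g x y) (k : ConjTo g z y) : x = z :=
  h.symm.eq k.symm

theorem conjTo_unit (x : L) : ConjTo (unit : L) x x := by
  have h1 : [unit, x, unit] ∈ (D : Set (List L)) := by
    have h := contract_mem [] [] [x] (by simpa using single_mem x)
    have k := contract_mem [unit, x] [] [] (by simpa [unit] using h)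
    simpa [unit] using k
  have h2 := same_unit [] [x, unit] (by simpa using h1)
  refine ⟨by simpa [unit_inv] using h1, ?_⟩
  have e2 := h2.2
  simp only [List.nil_append, List.cons_append, prod_unit_right] at e2
  rw [unit_inv, e2]

end PartialGroup

open PartialGroup in
/-- A subgroup of the partial group `L`: a subset `H` containing all inverses of its elements, such
that every word in `H` has a product, lying in `H`. -/
@[ext] structure PSubgroup (L : Type u) [PartialGroup L] where
  carrier : Set L
  word_mem : ∀ w : List L, (∀ g ∈ w, g ∈ carrier) → w ∈ (D : Set (List L))
  prod_mem : ∀ w : List L, (∀ g ∈ w, g ∈ carrier) → prod w ∈ carrier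
  inv_mem : ∀ g ∈ carrier, g⁻¹ ∈ carrier

namespace PSubgroup

open PartialGroup

variable {L : Type u} [PartialGroup L]

instance : SetLike (PSubgroup L) L where
  coe H := H.carrier
  coe_injective := by
    intro H K h
    exact PSubgroup.ext h

theorem mul_mem (H : PSubgroup L) {a b : L} (ha : a ∈ H) (hb : b ∈ H) : prod [a, b] ∈ H :=
  H.prod_mem _ (by
    intro g hg
    simp only [List.mem_cons, List.not_mem_nil, or_false] at hg
    rcases hg with rfl | rfl
    · exact ha
    · exact hb)

instance (H : PSubgroup L) : Mul H := ⟨fun a b => ⟨prod [(a : L), b], H.mul_mem a.2 b.2⟩⟩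

instance (H : PSubgroup L) : One H := ⟨⟨unit, H.prod_mem [] (by simp)⟩⟩

instance (H : PSubgroup L) : Inv H := ⟨fun a => ⟨(a : L)⁻¹, H.inv_mem a a.2⟩⟩

theorem coe_mul (H : PSubgroup L) (a b : H) : ((a * b : H) : L) = prod [(a : L), b] := rfl

theorem coe_one (H : PSubgroup L) : ((1 : H) : L) = unit := rfl

theorem coe_inv (H : PSubgroup L) (a : H) : ((a⁻¹ : H) : L) = (a : L)⁻¹ := rfl

theorem word3 (H : PSubgroup L) (a b c : H) : [(a : L), b, c] ∈ (D : Set (List L)) :=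
  H.word_mem _ (by
    intro g hg
    simp only [List.mem_cons, List.not_mem_nil, or_false] at hg
    rcases hg with rfl | rfl | rfl
    · exact a.2
    · exact b.2
    · exact c.2)

theorem mul_left_eq (H : PSubgroup L) (a b c : H) :
    ((a * b * c : H) : L) = prod [(a : L), b, c] := by
  have h := contract_prod [] [(a : L), b] [(c : L)] (by simpa using H.word3 a b c)
  simpa [coe_mul] using h.symm

/-- A subgroup of a partial group is a group, with multiplication `(a, b) ↦ Π (a, b)`. -/
instance (H : PSubgroup L) : Group H :=
  Group.ofLeftAxioms
    (by
      intro a b c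
      apply Subtype.ext
      rw [mul_left_eq]
      have h := contract_prod [(a : L)] [(b : L), c] [] (by simpa using H.word3 a b c)
      simpa [coe_mul] using h)
    (by
      intro a
      apply Subtype.ext
      rw [coe_mul, coe_one]
      exact prod_unit_left _)
    (by
      intro a
      apply Subtype.ext
      rw [coe_mul, coe_inv, coe_one]
      exact inv_mul_unit _)

/-- Inside a subgroup of `L`, conjugation in `L` is conjugation in the group. -/
theorem conjTo_coe (H : PSubgroup L) (s x : H) :
    ConjTo (s : L) (x : L) ((s⁻¹ * x * s : H) : L) :=
  ⟨H.word3 s⁻¹ x s, (H.mul_left_eq s⁻¹ x s).symm⟩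

end PSubgroup

/-! ### Localities -/

section Chains

open PartialGroup

variable {L : Type u} [PartialGroup L] {S : PSubgroup L}

/-- `P ^ g = Q`: conjugation by `g` is defined on `P`, with image `Q`. -/
def ConjEq (P : Subgroup S) (g : L) (Q : Subgroup S) : Prop :=
  (∀ x ∈ P, ∃ y ∈ Q, ConjTo g (x : L) (y : L)) ∧ (∀ y ∈ Q, ∃ x ∈ P, ConjTo g (x : L) (y : L))

/-- `Via Δ (g₁, …, gₙ) P₀` says that there are `P₁, …, Pₙ` such that all of `P₀, …, Pₙ` are in `Δ`
and `Pᵢ₋₁ ^ gᵢ = Pᵢ` for all `i`. -/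
def Via (Δ : Set (Subgroup S)) : List L → Subgroup S → Prop
  | [], P => P ∈ Δ
  | g :: w, P => P ∈ Δ ∧ ∃ Q, ConjEq P g Q ∧ Via Δ w Q

/-- The transporter set `N_L(P, Q)`: all `g` such that `P ≤ S_g` and `P ^ g ≤ Q`. -/
def Transp (P Q : Subgroup S) : Set L :=
  {g | ∀ x ∈ P, ∃ y ∈ Q, ConjTo g (x : L) (y : L)}

/-- `x` lies in `S_w`: it is an element of `S` that is conjugated successively into `S` by the
entries of the word `w`. -/
def InS (S : PSubgroup L) : List L → L → Prop
  | [], x => x ∈ S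
  | g :: w, x => x ∈ S ∧ ∃ y, ConjTo g x y ∧ InS S w y

theorem Via.mem {Δ : Set (Subgroup S)} {w : List L} {P : Subgroup S} (h : Via Δ w P) : P ∈ Δ := by
  cases w with
  | nil => exact h
  | cons g w => exact h.1

theorem ConjEq.symm {P Q : Subgroup S} {g : L} (h : ConjEq P g Q) : ConjEq Q g⁻¹ P := by
  refine ⟨fun y hy => ?_, fun x hx => ?_⟩
  · obtain ⟨x, hx, k⟩ := h.2 y hy
    exact ⟨x, hx, k.symm⟩
  · obtain ⟨y, hy, k⟩ := h.1 x hx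
    exact ⟨y, hy, k.symm⟩

/-- The subgroup `s⁻¹ P s` of `S`. -/
def conjSub (P : Subgroup S) (s : S) : Subgroup S := P.map (MulAut.conj s⁻¹).toMonoidHom

theorem mem_conjSub {P : Subgroup S} {s z : S} : z ∈ conjSub P s ↔ ∃ x ∈ P, s⁻¹ * x * s = z := by
  simp [conjSub, Subgroup.mem_map]

theorem conjEq_conjSub (P : Subgroup S) (s : S) : ConjEq P (s : L) (conjSub P s) := by
  refine ⟨fun x hx => ⟨s⁻¹ * x * s, mem_conjSub.2 ⟨x, hx, rfl⟩, S.conjTo_coe s x⟩, ?_⟩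
  intro y hy
  obtain ⟨x, hx, rfl⟩ := mem_conjSub.1 hy
  exact ⟨x, hx, S.conjTo_coe s x⟩

theorem conjEq_self {P : Subgroup S} {x : S} (hx : x ∈ P) : ConjEq P (x : L) P := by
  refine ⟨fun y hy => ⟨x⁻¹ * y * x, mul_mem (mul_mem (inv_mem hx) hy) hx, S.conjTo_coe x y⟩, ?_⟩
  intro y hy
  refine ⟨x * y * x⁻¹, mul_mem (mul_mem hx hy) (inv_mem hx), ?_⟩
  have h := S.conjTo_coe x (x * y * x⁻¹)
  have e : x⁻¹ * (x * y * x⁻¹) * x = y := by group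
  rwa [e] at h

end Chains

open PartialGroup in
/-- A pre-locality `(L, Δ, S)`: a `p`-subgroup `S` of the partial group `L` and a set `Δ` of subgroups
of `S` with `S ∈ Δ` such that `(L, Δ)` is objective. The latter means that a word is in the domain
of the product if and only if it conjugates some member of `Δ` successively to members of `Δ`, and
that every subgroup of `S` that contains an `L`-conjugate of a member of `Δ` is in `Δ`. -/
structure PreLocality (p : ℕ) (L : Type u) [PartialGroup L] where
  S : PSubgroup L
  isPGroup : IsPGroup p S
  Δ : Set (Subgroup S)
  top_mem : ⊤ ∈ Δ
  mem_D_iff : ∀ w : List L, w ∈ (D : Set (List L)) ↔ ∃ P, Via Δ w P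
  closed : ∀ (X Y : Subgroup S) (g : L), X ∈ Δ → g ∈ Transp X Y → Y ∈ Δ

namespace PreLocality

open PartialGroup

variable {p : ℕ} {L : Type u} [PartialGroup L] (M : PreLocality p L)

theorem conjSub_mem {P : Subgroup M.S} (hP : P ∈ M.Δ) (s : M.S) : conjSub P s ∈ M.Δ :=
  M.closed P _ s hP (conjEq_conjSub P s).1

theorem mem_of_le {P Q : Subgroup M.S} (hP : P ∈ M.Δ) (h : P ≤ Q) : Q ∈ M.Δ :=
  M.closed P Q unit hP (fun x hx => ⟨x, h hx, conjTo_unit _⟩)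

/-- If `a ^ g = b` with `a, b ∈ S`, then `(a⁻¹, g, b)` is in the domain, with product `g`. -/
theorem twist {g : L} {a b : M.S} (h : ConjTo g (a : L) (b : L)) :
    [(a : L)⁻¹, g, (b : L)] ∈ (D : Set (List L)) ∧ prod [(a : L)⁻¹, g, (b : L)] = g := by
  obtain ⟨h, e⟩ := h
  have h1 : [(a : L)⁻¹, g, g⁻¹, (a : L), g] ∈ (D : Set (List L)) := by
    refine right_mem [g⁻¹] _ ?_
    simpa [winv, invol] using winv_append_mem h
  have h2 := same_contract [(a : L)⁻¹, g] [g⁻¹, (a : L), g] [] (by simpa using h1)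
  have h3 := same_cancel [(a : L)⁻¹] g [(a : L), g] (by simpa using h1)
  have h4 := same_cancel_inv [] (a : L) [g] (by simpa using h3.1)
  have e2 := h2.2
  have e3 := h3.2
  have e4 := h4.2
  have m2 := h2.1
  simp only [List.nil_append, List.append_nil, List.cons_append, prod_single, e] at e2 e3 e4 m2
  exact ⟨m2, by rw [← e2, e3, e4]⟩

theorem conjTo_twist {g : L} {X Y : Subgroup M.S} (hX : X ∈ M.Δ) (hY : Y ∈ M.Δ)
    (hXY : ConjEq X g Y) {a b : M.S} (h : ConjTo g (a : L) (b : L)) {x y : M.S} (hx : x ∈ X)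
    (k : ConjTo g (x : L) (y : L)) :
    ConjTo g ((a⁻¹ * x * a : M.S) : L) ((b⁻¹ * y * b : M.S) : L) := by
  have hXa := conjEq_conjSub X a
  have hYb := conjEq_conjSub Y b
  have mXa := M.conjSub_mem hX a
  have mYb := M.conjSub_mem hY b
  have hW : [(b : L)⁻¹, g⁻¹, (a : L), (a : L)⁻¹, (x : L), (a : L), (a : L)⁻¹, g, (b : L)] ∈
      (D : Set (List L)) := by
    rw [M.mem_D_iff]
    exact ⟨conjSub Y b, mYb, _, hYb.symm, hY, _, hXY.symm, hX, _, hXa, mXa, _, hXa.symm, hX, _,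
      conjEq_self hx, hX, _, hXa, mXa, _, hXa.symm, hX, _, hXY, hY, _, hYb, mYb⟩
  obtain ⟨t1, t2⟩ := M.twist h
  have t3 : prod [(b : L)⁻¹, g⁻¹, (a : L)] = g⁻¹ := by
    have := prod_winv t1
    rw [t2] at this
    simpa [winv, invol] using this
  have c1 := same_contract [] [(b : L)⁻¹, g⁻¹, (a : L)]
    [(a : L)⁻¹, (x : L), (a : L), (a : L)⁻¹, g, (b : L)] (by simpa using hW)
  have c2 := same_contract [g⁻¹] [(a : L)⁻¹, (x : L), (a : L)] [(a : L)⁻¹, g, (b : L)]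
    (by simpa [t3] using c1.1)
  have c3 := same_contract [g⁻¹, prod [(a : L)⁻¹, (x : L), (a : L)]] [(a : L)⁻¹, g, (b : L)] []
    (by simpa using c2.1)
  have d1 := same_cancel [(b : L)⁻¹, g⁻¹] (a : L) [(x : L), (a : L), (a : L)⁻¹, g, (b : L)]
    (by simpa using hW)
  have d2 := same_cancel [(b : L)⁻¹, g⁻¹, (x : L)] (a : L) [g, (b : L)] (by simpa using d1.1)
  have d3 := same_contract [(b : L)⁻¹] [g⁻¹, (x : L), g] [(b : L)] (by simpa using d2.1)
  have e1 := c1.2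
  have e2 := c2.2
  have e3 := c3.2
  have f1 := d1.2
  have f2 := d2.2
  have f3 := d3.2
  have m3 := c3.1
  simp only [List.nil_append, List.append_nil, List.cons_append, t2, t3, k.2] at e1 e2 e3 f1 f2 f3 m3
  have ea : ((a⁻¹ * x * a : M.S) : L) = prod [(a : L)⁻¹, (x : L), (a : L)] := M.S.mul_left_eq a⁻¹ x a
  have eb : ((b⁻¹ * y * b : M.S) : L) = prod [(b : L)⁻¹, (y : L), (b : L)] := M.S.mul_left_eq b⁻¹ y b
  rw [ConjTo, ea, eb]
  exact ⟨m3, by rw [← e3, ← e2, ← e1, f1, f2, f3]⟩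

theorem conjEq_twist {g : L} {X Y : Subgroup M.S} (hX : X ∈ M.Δ) (hY : Y ∈ M.Δ)
    (hXY : ConjEq X g Y) {a b : M.S} (h : ConjTo g (a : L) (b : L)) :
    ConjEq (conjSub X a) g (conjSub Y b) := by
  constructor
  · intro z hz
    obtain ⟨x, hx, rfl⟩ := mem_conjSub.1 hz
    obtain ⟨y, hy, k⟩ := hXY.1 x hx
    exact ⟨_, mem_conjSub.2 ⟨y, hy, rfl⟩, M.conjTo_twist hX hY hXY h hx k⟩
  · intro z hz
    obtain ⟨y, hy, rfl⟩ := mem_conjSub.1 hz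
    obtain ⟨x, hx, k⟩ := hXY.2 y hy
    exact ⟨_, mem_conjSub.2 ⟨x, hx, rfl⟩, M.conjTo_twist hX hY hXY h hx k⟩

/-- Conjugation by `g` is multiplicative on `S_g`. -/
theorem conjTo_mul {g : L} {a b c d : M.S} (h : ConjTo g (a : L) (b : L))
    (k : ConjTo g (c : L) (d : L)) : ConjTo g ((a * c : M.S) : L) ((b * d : M.S) : L) := by
  obtain ⟨X, hX, Y, hXY, hY⟩ := (M.mem_D_iff [g]).1 (single_mem g)
  have hY : Y ∈ M.Δ := hY
  have mXa := M.conjSub_mem hX a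
  have mYb := M.conjSub_mem hY b
  have r1 := M.conjEq_twist hX hY hXY h
  have r2 := M.conjEq_twist mXa mYb r1 k
  have mXac := M.conjSub_mem mXa c
  have mYbd := M.conjSub_mem mYb d
  have hW : [g⁻¹, (a : L), g, g⁻¹, (c : L), g] ∈ (D : Set (List L)) := by
    rw [M.mem_D_iff]
    exact ⟨Y, hY, _, hXY.symm, hX, _, conjEq_conjSub X a, mXa, _, r1, mYb, _, r1.symm, mXa, _,
      conjEq_conjSub _ c, mXac, _, r2, mYbd⟩
  have c1 := same_cancel [g⁻¹, (a : L)] g [(c : L), g] (by simpa using hW)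
  have c2 := same_contract [g⁻¹] [(a : L), (c : L)] [g] (by simpa using c1.1)
  have d1 := same_contract [] [g⁻¹, (a : L), g] [g⁻¹, (c : L), g] (by simpa using hW)
  have d2 := same_contract [prod [g⁻¹, (a : L), g]] [g⁻¹, (c : L), g] [] (by simpa using d1.1)
  have e1 := c1.2
  have e2 := c2.2
  have f1 := d1.2
  have f2 := d2.2
  have m2 := c2.1
  simp only [List.nil_append, List.append_nil, List.cons_append, h.2, k.2] at e1 e2 f1 f2 m2
  rw [ConjTo, M.S.coe_mul, M.S.coe_mul]
  exact ⟨m2, by rw [← e2, ← e1, f1, f2]⟩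

theorem conjTo_one (g : L) : ConjTo g ((1 : M.S) : L) ((1 : M.S) : L) := by
  have h : [g⁻¹, g] ∈ (D : Set (List L)) := by simpa [winv] using winv_append_mem (single_mem g)
  have h1 := contract_mem [g⁻¹] [] [g] (by simpa using h)
  have h2 := contract_prod [g⁻¹] [] [g] (by simpa using h)
  rw [M.S.coe_one]
  refine ⟨by simpa [unit] using h1, ?_⟩
  simp only [List.append_nil, List.cons_append, List.nil_append, inv_mul_unit] at h2
  exact h2.symm

/-- For `g ∈ N_L(P, Q)`, the conjugation homomorphism `c_g : P → Q`. -/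
noncomputable def conjHom {P Q : Subgroup M.S} (g : L) (hg : g ∈ Transp P Q) : P →* Q where
  toFun x := ⟨(hg x x.2).choose, (hg x x.2).choose_spec.1⟩
  map_one' := by
    apply Subtype.ext
    apply Subtype.ext
    exact (hg _ (1 : P).2).choose_spec.2.eq (M.conjTo_one g)
  map_mul' x y := by
    apply Subtype.ext
    apply Subtype.ext
    exact (hg _ (x * y).2).choose_spec.2.eq
      (M.conjTo_mul (hg x x.2).choose_spec.2 (hg y y.2).choose_spec.2)

/-- The defining property of `c_g`: it sends `x` to `x ^ g`. -/
theorem conjHom_spec {P Q : Subgroup M.S} (g : L) (hg : g ∈ Transp P Q) (x : P) :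
    ConjTo g ((x : M.S) : L) ((M.conjHom g hg x : M.S) : L) :=
  (hg x x.2).choose_spec.2

theorem conjHom_injective {P Q : Subgroup M.S} (g : L) (hg : g ∈ Transp P Q) :
    Function.Injective (M.conjHom g hg) := by
  intro x y h
  have hx := M.conjHom_spec g hg x
  rw [h] at hx
  exact Subtype.ext (Subtype.ext (hx.inj (M.conjHom_spec g hg y)))

/-- The image `P ^ g`. -/
noncomputable def image {P Q : Subgroup M.S} (g : L) (hg : g ∈ Transp P Q) : Subgroup M.S :=
  (M.conjHom g hg).range.map Q.subtype

theorem image_le {P Q : Subgroup M.S} (g : L) (hg : g ∈ Transp P Q) : M.image g hg ≤ Q := by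
  intro y hy
  obtain ⟨z, -, rfl⟩ := hy
  exact z.2

theorem conjEq_image {P Q : Subgroup M.S} (g : L) (hg : g ∈ Transp P Q) :
    ConjEq P g (M.image g hg) := by
  constructor
  · intro x hx
    exact ⟨_, ⟨M.conjHom g hg ⟨x, hx⟩, ⟨_, rfl⟩, rfl⟩, M.conjHom_spec g hg ⟨x, hx⟩⟩
  · intro y hy
    obtain ⟨z, ⟨x, rfl⟩, rfl⟩ := hy
    exact ⟨x, x.2, M.conjHom_spec g hg x⟩

theorem image_mem {P Q : Subgroup M.S} (hP : P ∈ M.Δ) (g : L) (hg : g ∈ Transp P Q) :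
    M.image g hg ∈ M.Δ :=
  M.closed P _ g hP (M.conjEq_image g hg).1

theorem mul_mem_D {P Q R : Subgroup M.S} (hP : P ∈ M.Δ) {g h : L} (hg : g ∈ Transp P Q)
    (hh : h ∈ Transp Q R) : [g, h] ∈ (D : Set (List L)) := by
  rw [M.mem_D_iff]
  have hh2 : h ∈ Transp (M.image g hg) R := fun x hx => hh x (M.image_le g hg hx)
  have h1 := M.image_mem hP g hg
  exact ⟨P, hP, _, M.conjEq_image g hg, h1, _, M.conjEq_image h hh2, M.image_mem h1 h hh2⟩

theorem mul3_mem_D {P Q R T : Subgroup M.S} (hP : P ∈ M.Δ) {g h k : L} (hg : g ∈ Transp P Q)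
    (hh : h ∈ Transp Q R) (hk : k ∈ Transp R T) : [g, h, k] ∈ (D : Set (List L)) := by
  rw [M.mem_D_iff]
  have hh2 : h ∈ Transp (M.image g hg) R := fun x hx => hh x (M.image_le g hg hx)
  have h1 := M.image_mem hP g hg
  have h2 := M.image_mem h1 h hh2
  have hk2 : k ∈ Transp (M.image h hh2) T := fun x hx => hk x (M.image_le h hh2 hx)
  exact ⟨P, hP, _, M.conjEq_image g hg, h1, _, M.conjEq_image h hh2, h2, _,
    M.conjEq_image k hk2, M.image_mem h2 k hk2⟩

/-- `x ^ (g h) = (x ^ g) ^ h` for `x ∈ P ∈ Δ`. -/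
theorem conjTo_comp {P Q R : Subgroup M.S} (hP : P ∈ M.Δ) {g h : L} (hg : g ∈ Transp P Q)
    (hh : h ∈ Transp Q R) {x : M.S} (hx : x ∈ P) {y z : L} (k : ConjTo g (x : L) y)
    (l : ConjTo h y z) : ConjTo (prod [g, h]) (x : L) z := by
  have hh2 : h ∈ Transp (M.image g hg) R := fun x hx => hh x (M.image_le g hg hx)
  have h1 := M.image_mem hP g hg
  have h2 := M.image_mem h1 h hh2
  have r1 := M.conjEq_image g hg
  have r2 := M.conjEq_image h hh2
  have hW : [h⁻¹, g⁻¹, (x : L), g, h] ∈ (D : Set (List L)) := by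
    rw [M.mem_D_iff]
    exact ⟨_, h2, _, r2.symm, h1, _, r1.symm, hP, _, conjEq_self hx, hP, _, r1, h1, _, r2, h2⟩
  have t : prod [h⁻¹, g⁻¹] = (prod [g, h])⁻¹ := by
    have := prod_winv (M.mul_mem_D hP hg hh)
    simpa [winv] using this
  have c1 := same_contract [] [h⁻¹, g⁻¹] [(x : L), g, h] (by simpa using hW)
  have c2 := same_contract [prod [h⁻¹, g⁻¹], (x : L)] [g, h] [] (by simpa using c1.1)
  have d1 := same_contract [h⁻¹] [g⁻¹, (x : L), g] [h] (by simpa using hW)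
  have e1 := c1.2
  have e2 := c2.2
  have f1 := d1.2
  have m2 := c2.1
  simp only [List.nil_append, List.append_nil, List.cons_append, t, k.2, l.2] at e1 e2 f1 m2
  exact ⟨m2, by rw [← e2, ← e1, f1]⟩

theorem trans_mul {P Q R : Subgroup M.S} (hP : P ∈ M.Δ) {g h : L} (hg : g ∈ Transp P Q)
    (hh : h ∈ Transp Q R) : prod [g, h] ∈ (Transp P R : Set L) := by
  intro x hx
  obtain ⟨y, hy, k⟩ := hg x hx
  obtain ⟨z, hz, l⟩ := hh y hy
  exact ⟨z, hz, M.conjTo_comp hP hg hh hx k l⟩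

theorem unit_mem_trans {P Q : Subgroup M.S} (h : P ≤ Q) : unit ∈ (Transp P Q : Set L) :=
  fun x hx => ⟨x, h hx, conjTo_unit _⟩

/-- For `P ∈ Δ`, the normalizer `N_L(P) = {g ∈ L | P ^ g = P}`, which is a subgroup of `L`. -/
def normalizer (P : Subgroup M.S) (hP : P ∈ M.Δ) : PSubgroup L where
  carrier := {g | ConjEq P g P}
  word_mem w hw := by
    rw [M.mem_D_iff]
    refine ⟨P, ?_⟩
    induction w with
    | nil => exact hP
    | cons g w ih =>
      exact ⟨hP, P, hw g (by simp), ih (fun k hk => hw k (by simp [hk]))⟩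
  prod_mem w hw := by
    have key : w ∈ (D : Set (List L)) ∧ ConjEq P (prod w) P := by
      induction w with
      | nil =>
        exact ⟨nil_mem, fun x hx => ⟨x, hx, conjTo_unit _⟩, fun x hx => ⟨x, hx, conjTo_unit _⟩⟩
      | cons g w ih =>
        have hg : ConjEq P g P := hw g (by simp)
        obtain ⟨-, h⟩ := ih (fun k hk => hw k (by simp [hk]))
        have hD : g :: w ∈ (D : Set (List L)) := by
          rw [M.mem_D_iff]
          refine ⟨P, ?_⟩
          have hw2 : ∀ k ∈ w, ConjEq P k P := fun k hk => hw k (by simp [hk])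
          clear hw ih h
          refine ⟨hP, P, hg, ?_⟩
          induction w with
          | nil => exact hP
          | cons k w ih => exact ⟨hP, P, hw2 k (by simp), ih (fun l hl => hw2 l (by simp [hl]))⟩
        have e := contract_prod [g] w [] (by simpa using hD)
        simp only [List.append_nil, List.cons_append, List.nil_append] at e
        refine ⟨hD, ?_⟩
        rw [e]
        refine ⟨M.trans_mul hP hg.1 h.1, fun z hz => ?_⟩
        obtain ⟨y, hy, l⟩ := h.2 z hz
        obtain ⟨x, hx, k⟩ := hg.2 y hy
        exact ⟨x, hx, M.conjTo_comp hP hg.1 h.1 hx k l⟩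
    exact key.2
  inv_mem g hg := ConjEq.symm hg

/-- The centralizer `C_L(P) = {g ∈ L | x ^ g = x for all x ∈ P}`. -/
def centralizer (P : Subgroup M.S) : Set L := {g | ∀ x ∈ P, ConjTo g (x : L) (x : L)}

end PreLocality

/-! ### Groups -/

/-- The Prüfer group `ℤ(p^∞)`: the `p`-power torsion of `ℚ / ℤ`. -/
def pruferSubgroup (p : ℕ) : AddSubgroup (AddCircle (1 : ℚ)) where
  carrier := {x | ∃ n : ℕ, (p ^ n) • x = 0}
  zero_mem' := ⟨0, by simp⟩
  add_mem' := by
    rintro x y ⟨m, hm⟩ ⟨n, hn⟩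
    refine ⟨m + n, ?_⟩
    rw [smul_add, pow_add, mul_smul, mul_smul, hn, smul_zero, smul_comm, hm, smul_zero, add_zero]
  neg_mem' := by
    rintro x ⟨m, hm⟩
    exact ⟨m, by rw [smul_neg, hm, neg_zero]⟩

/-- A `p`-torus: a direct product of finitely many copies of the Prüfer group. -/
def IsTorus (p : ℕ) (T : Type*) [Group T] : Prop :=
  ∃ k : ℕ, Nonempty (T ≃* (Fin k → Multiplicative (pruferSubgroup p)))

/-- `G` is virtually `p`-toral: some subgroup of finite index is a `p`-torus. -/
def IsVirtuallyToral (p : ℕ) (G : Type*) [Group G] : Prop :=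
  ∃ T : Subgroup G, T.FiniteIndex ∧ IsTorus p T

/-- `O_p(G)`: the subgroup generated by (equivalently, the largest of) the normal `p`-subgroups. -/
def pRadical (p : ℕ) (G : Type*) [Group G] : Subgroup G :=
  sSup {N : Subgroup G | N.Normal ∧ IsPGroup p N}

/-- `G` is of characteristic `p`: `C_G(O_p(G)) ≤ O_p(G)`. -/
def IsOfCharacteristic (p : ℕ) (G : Type*) [Group G] : Prop :=
  Subgroup.centralizer (pRadical p G : Set G) ≤ pRadical p G

/-- The normalizer-increasing property: `X < N_Y(X)` whenever `X < Y` are subgroups. -/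
def IsNormalizerIncreasing (S : Type*) [Group S] : Prop :=
  ∀ X Y : Subgroup S, X < Y → ∃ y ∈ Y, y ∉ X ∧ ∀ x : S, x ∈ X ↔ y⁻¹ * x * y ∈ X

/-- The transporter set `N_S(P, Q) = {s ∈ S | P ^ s ≤ Q}` in a group `S`. -/
def GTransp {S : Type*} [Group S] (P Q : Subgroup S) : Set S := {s | ∀ x ∈ P, s⁻¹ * x * s ∈ Q}

/-! ### Fusion systems -/

/-- A fusion system on the group `S`: for all `P, Q ≤ S` a set of injective homomorphisms `P → Q`,
containing all conjugation maps by elements of `S` (hence all inclusions), closed under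
composition, and such that every morphism is an isomorphism of the system (one whose inverse is a
morphism as well) followed by an inclusion. -/
structure FusionSystem (S : Type u) [Group S] where
  IsHom : ∀ {P Q : Subgroup S}, (P →* Q) → Prop
  injective : ∀ {P Q : Subgroup S} (φ : P →* Q), IsHom φ → Function.Injective φ
  conj : ∀ {P Q : Subgroup S} (s : S) (φ : P →* Q),
    (∀ x : P, (φ x : S) = s⁻¹ * x * s) → IsHom φ
  comp : ∀ {P Q R : Subgroup S} (φ : P →* Q) (ψ : Q →* R), IsHom φ → IsHom ψ → IsHom (ψ.comp φ)
  codRestrict : ∀ {P Q R : Subgroup S} (φ : P →* Q) (ψ : P →* R), IsHom φ →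
    (∀ x : P, (ψ x : S) = φ x) → IsHom ψ
  symm : ∀ {P Q : Subgroup S} (e : P ≃* Q), IsHom e.toMonoidHom → IsHom e.symm.toMonoidHom

namespace FusionSystem

open CategoryTheory

section Generate

variable {S : Type u} [Group S]

/-- The morphisms of the fusion system generated by a set `X` of homomorphisms. -/
inductive Generated (X : ∀ P Q : Subgroup S, (P →* Q) → Prop) :
    ∀ P Q : Subgroup S, (P →* Q) → Prop
  | of {P Q : Subgroup S} (φ : P →* Q) (h : X P Q φ) : Generated X P Q φ
  | conj {P Q : Subgroup S} (s : S) (φ : P →* Q) (h : ∀ x : P, (φ x : S) = s⁻¹ * x * s) :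
      Generated X P Q φ
  | comp {P Q R : Subgroup S} (φ : P →* Q) (ψ : Q →* R) (h : Generated X P Q φ)
      (k : Generated X Q R ψ) : Generated X P R (ψ.comp φ)
  | codRestrict {P Q R : Subgroup S} (φ : P →* Q) (ψ : P →* R) (h : Generated X P Q φ)
      (e : ∀ x : P, (ψ x : S) = φ x) : Generated X P R ψ
  | symm {P Q : Subgroup S} (e : P ≃* Q) (h : Generated X P Q e.toMonoidHom) :
      Generated X Q P e.symm.toMonoidHom

/-- The fusion system generated by a set `X` of injective homomorphisms, i.e. the smallest fusion
system on `S` that contains `X`. -/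
def generate (X : ∀ P Q : Subgroup S, (P →* Q) → Prop)
    (hX : ∀ (P Q : Subgroup S) (φ : P →* Q), X P Q φ → Function.Injective φ) :
    FusionSystem S where
  IsHom {P Q} φ := Generated X P Q φ
  injective := by
    intro P Q φ h
    induction h with
    | of φ h => exact hX _ _ φ h
    | conj s φ h =>
      intro x y e
      have : (φ x : S) = φ y := by rw [e]
      rw [h, h] at this
      exact Subtype.ext (mul_left_cancel (mul_right_cancel this))
    | comp φ ψ _ _ ih ik => exact ik.comp ih
    | codRestrict φ ψ _ e ih =>
      intro x y k
      apply ih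
      apply Subtype.ext
      rw [← e, ← e, k]
    | symm e _ _ => exact e.symm.injective
  conj := Generated.conj
  comp := Generated.comp
  codRestrict := Generated.codRestrict
  symm := Generated.symm

end Generate

variable {S : Type u} [Group S] (F : FusionSystem S)

theorem id_isHom (P : Subgroup S) : F.IsHom (MonoidHom.id P) :=
  F.conj 1 _ (by intro x; simp)

/-- `Q` is an `F`-conjugate of `P`. -/
def IsConj (P Q : Subgroup S) : Prop := ∃ e : P ≃* Q, F.IsHom e.toMonoidHom

/-- `P` is `F`-centric: `C_S(Q) ≤ Q` for every `F`-conjugate `Q` of `P`. -/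
def IsCentric (P : Subgroup S) : Prop :=
  ∀ Q : Subgroup S, F.IsConj P Q → Subgroup.centralizer (Q : Set S) ≤ Q

/-- The group `Aut_F(P)`. -/
def aut (P : Subgroup S) : Subgroup (MulAut P) where
  carrier := {α | F.IsHom (α : P ≃* P).toMonoidHom}
  one_mem' := F.id_isHom P
  mul_mem' hα hβ := F.comp _ _ hβ hα
  inv_mem' hα := F.symm _ hα

/-- The group `Out_F(P) = Aut_F(P) / Inn(P)`. -/
abbrev Out (P : Subgroup S) : Type u :=
  F.aut P ⧸ ((MulAut.conj : P →* MulAut P).range.subgroupOf (F.aut P))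

instance (P : Subgroup S) : ((MulAut.conj : P →* MulAut P).range.subgroupOf (F.aut P)).Normal := by
  have : ((MulAut.conj : P →* MulAut P).range).Normal := by
    constructor
    rintro _ ⟨x, rfl⟩ α
    refine ⟨α x, ?_⟩
    ext y
    simp [MulAut.conj_apply]
  infer_instance

/-- `P` is `F`-radical: `O_p(Out_F(P)) = 1`. -/
def IsRadical (p : ℕ) (P : Subgroup S) : Prop := pRadical p (F.Out P) = ⊥

/-- An object of the fusion system regarded as a category: a subgroup of `S`. -/
structure Obj (F : FusionSystem S) where
  grp : Subgroup S

/-- The fusion system as a category. -/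
instance : Category F.Obj where
  Hom P Q := {φ : P.grp →* Q.grp // F.IsHom φ}
  id P := ⟨MonoidHom.id _, F.id_isHom _⟩
  comp φ ψ := ⟨ψ.1.comp φ.1, F.comp _ _ φ.2 ψ.2⟩

end FusionSystem

namespace PreLocality

variable {p : ℕ} {L : Type u} [PartialGroup L] (M : PreLocality p L)

/-- The fusion system `F_S(L)` on `S` generated by the conjugation maps `c_g : P → Q` for
`P, Q ∈ Δ` and `g ∈ N_L(P, Q)`. -/
noncomputable def fusion : FusionSystem M.S :=
  FusionSystem.generate
    (fun P Q φ => P ∈ M.Δ ∧ Q ∈ M.Δ ∧ ∃ (g : L) (hg : g ∈ Transp P Q), φ = M.conjHom g hg)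
    (by
      rintro P Q φ ⟨-, -, g, hg, rfl⟩
      exact M.conjHom_injective g hg)

/-- The poset `Ω_S(L)`, ordered by inclusion: all intersections of nonempty families of the sets
`S_w`, for words `w` in `L`. -/
def Omega : Set (Set L) :=
  {A | ∃ W : Set (List L), W.Nonempty ∧ A = {x | ∀ w ∈ W, InS M.S w x}}

end PreLocality

/-- A (discrete) locality `(L, Δ, S)`: a pre-locality in which `S` is a maximal `p`-subgroup of `L`
and the poset `Ω_S(L)` is finite-dimensional, i.e. there is a bound on the lengths of its strictly
increasing chains. -/
structure Locality (p : ℕ) (L : Type u) [PartialGroup L] extends PreLocality p L where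
  maximal : ∀ H : PSubgroup L, (∀ x ∈ S, x ∈ H) → IsPGroup p H → H = S
  finiteDim : ∃ n : ℕ, ∀ s : LTSeries toPreLocality.Omega, s.length ≤ n

namespace Locality

variable {p : ℕ} {L : Type u} [PartialGroup L]

/-- A proper locality: all centric radical subgroups are objects, the normalizers `N_L(P)` of
objects are of characteristic `p`, and `S` has the normalizer-increasing property. -/
structure IsProper (M : Locality p L) : Prop where
  centric_radical : ∀ P : Subgroup M.S, M.fusion.IsCentric P → M.fusion.IsRadical p P → P ∈ M.Δ
  characteristic : ∀ (P : Subgroup M.S) (hP : P ∈ M.Δ), IsOfCharacteristic p (M.normalizer P hP)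
  normalizerIncreasing : IsNormalizerIncreasing M.S

/-- A compact locality: a proper locality in which the normalizers `N_L(P)` of objects are virtually
`p`-toral. -/
structure IsCompact (M : Locality p L) : Prop where
  proper : M.IsProper
  toral : ∀ (P : Subgroup M.S) (hP : P ∈ M.Δ), IsVirtuallyToral p (M.normalizer P hP)

end Locality

/-! ### Transporter categories -/

namespace PreLocality

open CategoryTheory PartialGroup

variable {p : ℕ} {L : Type u} [PartialGroup L] (M : PreLocality p L)

/-- An object of the transporter category `T_Δ(S)`: a member of `Δ`. -/
structure TS (M : PreLocality p L) where
  grp : Subgroup M.S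
  mem : grp ∈ M.Δ

/-- An object of the transporter category `T = T_Δ(L)`: a member of `Δ`. -/
structure TL (M : PreLocality p L) where
  grp : Subgroup M.S
  mem : grp ∈ M.Δ

variable {M}

/-- The category `T_Δ(S)`: the morphisms `P → Q` are the elements of `N_S(P, Q)`. -/
instance : Category M.TS where
  Hom P Q := {s : M.S // s ∈ GTransp P.grp Q.grp}
  id P := ⟨1, fun x hx => by simpa using hx⟩
  comp s t := ⟨s.1 * t.1, fun x hx => by
    have h := t.2 _ (s.2 x hx)
    simpa [mul_assoc] using h⟩
  id_comp s := Subtype.ext (one_mul _)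
  comp_id s := Subtype.ext (mul_one _)
  assoc s t r := Subtype.ext (mul_assoc _ _ _)

/-- The category `T = T_Δ(L)`: the morphisms `P → Q` are the elements of `N_L(P, Q)`, and the
composite of `g : P → Q` followed by `h : Q → R` is `g h = Π (g, h)`. -/
instance : Category M.TL where
  Hom P Q := {g : L // g ∈ Transp P.grp Q.grp}
  id P := ⟨unit, M.unit_mem_trans le_rfl⟩
  comp {P _ _} g h := ⟨prod [g.1, h.1], M.trans_mul P.mem g.2 h.2⟩
  id_comp g := Subtype.ext (prod_unit_left _)
  comp_id g := Subtype.ext (prod_unit_right _)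
  assoc {P _ _ _} g h k := by
    apply Subtype.ext
    have w := M.mul3_mem_D P.mem g.2 h.2 k.2
    have e1 := contract_prod [] [g.1, h.1] [k.1] (by simpa using w)
    have e2 := contract_prod [g.1] [h.1, k.1] [] (by simpa using w)
    simp only [List.nil_append, List.append_nil, List.cons_append] at e1 e2
    exact e1.symm.trans e2

variable (M)

/-- The functor `ε : T_Δ(S) → T`: the identity on objects, and the inclusion
`N_S(P, Q) → N_L(P, Q)` on morphisms. -/
def eps : M.TS ⥤ M.TL where
  obj P := ⟨P.grp, P.mem⟩
  map s := ⟨(s.1 : L), fun x hx => ⟨_, s.2 x hx, M.S.conjTo_coe s.1 x⟩⟩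
  map_id _ := rfl
  map_comp _ _ := rfl

/-- The functor `ρ : T → F`: the inclusion on objects, and `g ↦ c_g` on morphisms. -/
noncomputable def rho : M.TL ⥤ M.fusion.Obj where
  obj P := ⟨P.grp⟩
  map {P Q} g := ⟨M.conjHom g.1 g.2, FusionSystem.Generated.of _ ⟨P.mem, Q.mem, g.1, g.2, rfl⟩⟩
  map_id P := by
    apply Subtype.ext
    ext x
    exact (M.conjHom_spec unit (M.unit_mem_trans le_rfl) x).eq (conjTo_unit ((x : M.S) : L))
  map_comp {P Q R} g h := by
    apply Subtype.ext
    ext x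
    exact (M.conjHom_spec (prod [g.1, h.1]) (M.trans_mul P.mem g.2 h.2) x).eq
      (M.conjTo_comp P.mem g.2 h.2 x.2 (M.conjHom_spec g.1 g.2 x) (M.conjHom_spec h.1 h.2 _))

variable {M}

/-- The map `ε_{P,Q} : N_S(P, Q) → Mor_T(P, Q)`. -/
def epsHom (P Q : M.TL) (s : GTransp P.grp Q.grp) : P ⟶ Q :=
  M.eps.map (X := ⟨P.grp, P.mem⟩) (Y := ⟨Q.grp, Q.mem⟩) s

/-- The map `ρ_{P,Q} : Mor_T(P, Q) → Hom_F(P, Q)`, with values regarded as homomorphisms. -/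
noncomputable def rhoHom {P Q : M.TL} (φ : P ⟶ Q) : P.grp →* Q.grp := (M.rho.map φ).1

/-- The `T`-automorphism `(x) ε_P` of `P` for `x ∈ P`, as a morphism. -/
def epsElt (P : M.TL) (x : P.grp) : P ⟶ P :=
  epsHom P P ⟨x, fun _ hy => mul_mem (mul_mem (inv_mem x.2) hy) x.2⟩

/-- The inclusion morphism `ι_{P,Q} = (1) ε_{P,Q}` for `P ≤ Q`. -/
def iota (P Q : M.TL) (h : P.grp ≤ Q.grp) : P ⟶ Q :=
  epsHom P Q ⟨1, fun x hx => by simpa using h hx⟩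

/-- `Ker(ρ_P)`, where `ρ_P : Aut_T(P) → Aut_F(P)`. -/
noncomputable def kerRho (P : M.TL) : Subgroup (Aut P) := (M.rho.mapAut P).ker

/-- The image of `N_S(P)`, the automorphism group of `P` in `T_Δ(S)`, under
`ε_P : N_S(P) → Aut_T(P)`. -/
def epsImage (P : M.TL) : Subgroup (Aut P) := (M.eps.mapAut (X := (⟨P.grp, P.mem⟩ : M.TS))).range

/-- The object `S` of `T`. -/
def topObj (M : PreLocality p L) : M.TL := ⟨⊤, M.top_mem⟩

end PreLocality

/-!
The intersections of subgroups `S_w` are the closed sets of a closure operator on subgroups of `S`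
that commutes with conjugation by elements of `L`. Since chains of closed subgroups have bounded
length, the height of the closure is a finite conjugation-invariant dimension, which drives both
finiteness arguments. First, `P ^ g ≤ P` makes `P` and `P ^ g` have the same closure; in the
normalizer of this closure `g` has finite order, so `P ^ g = P`. Second, choose `Q` among the
conjugates of `P` so that `N_S(Q)` has maximal dimension. By downward induction on the dimension,
every `p`-subgroup normalizing `N_S(Q)` is conjugate into `S`, and maximality forces `N_S(Q)` to be
a Sylow `p`-subgroup of `N_L(Q)`. Fullness of `ρ` holds because each generated fusion morphism is
conjugation by an element of `L` on every subgroup that is an object or has an object as its image;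
the rest is the calculus of conjugation in a partial group.
-/

section VirtuallyToral

variable {p : ℕ} {G H : Type*} [Group G] [Group H]

theorem lt_normalizer_of_finiteIndex [Fact p.Prime] (hG : IsPGroup p G) {X : Subgroup G}
    [X.FiniteIndex] (hX : X < ⊤) : X < Subgroup.normalizer (X : Set G) := by
  let π := QuotientGroup.mk' X.normalCore
  have hπ : Function.Surjective π := QuotientGroup.mk'_surjective _
  have comap_map : (X.map π).comap π = X :=
    Subgroup.comap_map_eq_self (by simpa only [π, QuotientGroup.ker_mk'] using X.normalCore_le)
  have : Group.IsNilpotent (G ⧸ X.normalCore) := (hG.to_quotient _).isNilpotent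
  have hlt := Group.normalizerCondition_of_isNilpotent (X.map π) <| by
    rwa [← Subgroup.comap_lt_comap_of_surjective hπ, comap_map, Subgroup.comap_top]
  rwa [← Subgroup.comap_lt_comap_of_surjective hπ, Subgroup.comap_normalizer_eq_of_surjective _ hπ,
    comap_map] at hlt

theorem finiteIndex_subgroupOf_sup (X W : Subgroup G) [W.Normal] [Finite W] :
    (X.subgroupOf (W ⊔ X)).FiniteIndex := by
  let f (w : W) : ↥(W ⊔ X) ⧸ X.subgroupOf (W ⊔ X) := (⟨w, le_sup_left (b := X) w.2⟩ : ↥(W ⊔ X))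
  have hf : Function.Surjective f := by
    rintro ⟨k, hk⟩
    obtain ⟨w, hw, x, hx, rfl⟩ := Subgroup.mem_sup_of_normal_left.1 hk
    refine ⟨⟨w, hw⟩, QuotientGroup.eq.2 ?_⟩
    simpa [Subgroup.mem_subgroupOf] using hx
  have := Finite.of_surjective f hf
  exact Subgroup.finiteIndex_of_finite_quotient

/-- `T` is a normal abelian `p`-subgroup of finite index with finite `p ^ n`-torsion for all `n`.
Unlike that of a torus of finite index, the existence of such a `T` passes to subgroups of `G`. -/
structure IsToralKernel (p : ℕ) {G : Type*} [Group G] (T : Subgroup G) : Prop where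
  normal : T.Normal
  finiteIndex : T.FiniteIndex
  isPGroup : IsPGroup p T
  mul_comm (s t : T) : s * t = t * s
  finite_torsion (n : ℕ) : {t : T | t ^ p ^ n = 1}.Finite

namespace IsToralKernel

variable {T : Subgroup G}

theorem comap (hT : IsToralKernel p T) {f : H →* G} (hf : Function.Injective f) :
    IsToralKernel p (T.comap f) := by
  have hinj : Function.Injective (f.subgroupComap T) := fun x y h =>
    Subtype.ext (hf (congrArg Subtype.val h))
  refine ⟨hT.normal.comap f, ⟨?_⟩, hT.isPGroup.comap_of_injective f hf, fun s t => ?_, fun n => ?_⟩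
  · have := hT.finiteIndex
    rw [Subgroup.index_comap]
    exact Subgroup.FiniteIndex.index_ne_zero
  · exact hinj (by rw [map_mul, map_mul, hT.mul_comm])
  · refine ((hT.finite_torsion n).preimage hinj.injOn).subset fun x (hx : x ^ p ^ n = 1) => ?_
    change f.subgroupComap T x ^ p ^ n = 1
    rw [← map_pow, hx, map_one]

theorem exists_finite_normal (hT : IsToralKernel p T) {t : G} (ht : t ∈ T) :
    ∃ W : Subgroup G, W.Normal ∧ Finite W ∧ t ∈ W := by
  have := hT.normal
  let : CommGroup T := { (inferInstance : Group T) with mul_comm := hT.mul_comm }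
  obtain ⟨n, hn⟩ := hT.isPGroup ⟨t, ht⟩
  let torsion : Subgroup T := (powMonoidHom (p ^ n)).ker
  have : Finite torsion := hT.finite_torsion n
  have : torsion.Characteristic := Subgroup.characteristic_iff_le_comap.2 fun φ x hx => by
    simp_all [torsion, MonoidHom.mem_ker, ← map_pow]
  exact ⟨torsion.map T.subtype, inferInstance, (torsion : Set T).toFinite.image T.subtype,
    ⟨t, ht⟩, hn, rfl⟩

theorem normalizerCondition [Fact p.Prime] (hT : IsToralKernel p T) (hG : IsPGroup p G) :
    NormalizerCondition G := by
  intro X hX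
  by_cases hTX : T ≤ X
  · have := hT.finiteIndex
    have := Subgroup.finiteIndex_of_le hTX
    exact lt_normalizer_of_finiteIndex hG hX
  obtain ⟨t, htT, htX⟩ := SetLike.not_le_iff_exists.1 hTX
  obtain ⟨W, _, _, htW⟩ := hT.exists_finite_normal htT
  let K := W ⊔ X
  have hXK : X ≤ K := le_sup_right
  have := finiteIndex_subgroupOf_sup X W
  have hlt : X.subgroupOf K < ⊤ := lt_top_iff_ne_top.2 fun h =>
    htX (Subgroup.subgroupOf_eq_top.1 h (le_sup_left (b := X) htW))
  have hlt := lt_normalizer_of_finiteIndex (hG.to_subgroup K) hlt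
  obtain ⟨⟨y, hyK⟩, hy, hyX⟩ := SetLike.exists_of_lt hlt
  rw [← Subgroup.subgroupOf_normalizer_eq hXK] at hy
  exact SetLike.lt_iff_le_and_exists.2 ⟨Subgroup.le_normalizer, y, hy, hyX⟩

end IsToralKernel

theorem finite_pruferSubgroup_torsion [Fact p.Prime] (n : ℕ) :
    {x : pruferSubgroup p | (p ^ n) • x = 0}.Finite :=
  ((AddCircle.finite_torsion (1 : ℚ) (pow_pos (Fact.out : p.Prime).pos n)).preimage
    Subtype.val_injective.injOn).subset fun _ hx => congrArg Subtype.val hx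

theorem isPGroup_multiplicative_pruferSubgroup :
    IsPGroup p (Multiplicative (pruferSubgroup p)) := by
  rintro ⟨x, n, hn⟩
  exact ⟨n, congrArg Multiplicative.ofAdd (Subtype.ext hn)⟩

theorem isPGroup_pi {ι : Type*} [Finite ι] {G : ι → Type*} [∀ i, Group (G i)]
    (hG : ∀ i, IsPGroup p (G i)) : IsPGroup p (∀ i, G i) := by
  have := Fintype.ofFinite ι
  intro f
  choose n hn using fun i => hG i (f i)
  refine ⟨∑ i, n i, funext fun i => ?_⟩
  obtain ⟨c, hc⟩ :=
    pow_dvd_pow p (Finset.single_le_sum_of_canonicallyOrdered (f := n) (Finset.mem_univ i))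
  rw [Pi.pow_apply, hc, pow_mul, hn, one_pow, Pi.one_apply]

namespace IsTorus

theorem isPGroup (hG : IsTorus p G) : IsPGroup p G := by
  obtain ⟨k, ⟨e⟩⟩ := hG
  exact .of_injective (isPGroup_pi fun _ => isPGroup_multiplicative_pruferSubgroup)
    e.toMonoidHom e.injective

theorem mul_comm (hG : IsTorus p G) (a b : G) : a * b = b * a := by
  obtain ⟨k, ⟨e⟩⟩ := hG
  exact e.injective (by rw [map_mul, map_mul, _root_.mul_comm])

theorem finite_torsion [Fact p.Prime] (hG : IsTorus p G) (n : ℕ) :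
    {t : G | t ^ p ^ n = 1}.Finite := by
  obtain ⟨k, ⟨e⟩⟩ := hG
  have hfin : {x : Multiplicative (pruferSubgroup p) | x ^ p ^ n = 1}.Finite :=
    finite_pruferSubgroup_torsion n
  refine ((Set.Finite.pi' fun _ : Fin k => hfin).preimage e.injective.injOn).subset
    fun t (ht : t ^ p ^ n = 1) i => ?_
  simpa using congrFun (congrArg e ht) i

end IsTorus

namespace IsVirtuallyToral

variable [Fact p.Prime]

theorem exists_isToralKernel (hG : IsVirtuallyToral p G) :
    ∃ T : Subgroup G, IsToralKernel p T := by
  obtain ⟨T, _, hT⟩ := hG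
  let incl := Subgroup.inclusion T.normalCore_le
  have hincl : Function.Injective incl := Subgroup.inclusion_injective _
  refine ⟨T.normalCore, inferInstance, inferInstance, hT.isPGroup.to_le T.normalCore_le,
    fun a b => hincl (hT.mul_comm (incl a) (incl b)), fun n => ?_⟩
  refine ((hT.finite_torsion n).preimage hincl.injOn).subset fun t (ht : t ^ p ^ n = 1) => ?_
  change incl t ^ p ^ n = 1
  rw [← map_pow, ht, map_one]

theorem normalizerCondition_of_injective (hG : IsVirtuallyToral p G) {f : H →* G}
    (hf : Function.Injective f) (hH : IsPGroup p H) : NormalizerCondition H := by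
  obtain ⟨T, hT⟩ := hG.exists_isToralKernel
  exact (hT.comap hf).normalizerCondition hH

theorem isOfFinOrder (hG : IsVirtuallyToral p G) (g : G) : IsOfFinOrder g := by
  obtain ⟨T, _, hT⟩ := hG
  obtain ⟨n, hn, -, hgn⟩ := Subgroup.exists_pow_mem_of_index_ne_zero
    (Subgroup.FiniteIndex.index_ne_zero (H := T)) g
  have hord : IsOfFinOrder (⟨g ^ n, hgn⟩ : T) :=
    hT.isPGroup.isOfFinOrder (Fact.out : p.Prime).ne_zero _
  exact (T.subtype.isOfFinOrder hord).of_pow hn.ne'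

theorem finiteIndex_sylow (hG : IsVirtuallyToral p G) (P : Sylow p G) :
    (P : Subgroup G).FiniteIndex := by
  obtain ⟨T, hT⟩ := hG.exists_isToralKernel
  have := hT.normal
  have := hT.finiteIndex
  exact Subgroup.finiteIndex_of_le (hT.isPGroup.le_sylow_of_normal P)

theorem exists_conj_le_sylow (hG : IsVirtuallyToral p G) {X : Subgroup G} (hX : IsPGroup p X)
    (P : Sylow p G) : ∃ g : G, ∀ x ∈ X, g⁻¹ * x * g ∈ P := by
  have := hG.finiteIndex_sylow P
  have := P.finite_of_finiteIndex
  obtain ⟨Q, hXQ⟩ := hX.exists_le_sylow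
  obtain ⟨g, rfl⟩ := MulAction.exists_smul_eq G P Q
  refine ⟨g, fun x hx => ?_⟩
  have hx := Subgroup.mem_pointwise_smul_iff_inv_smul_mem.1 (hXQ hx)
  rwa [← map_inv, MulAut.smul_def, MulAut.conj_apply, inv_inv] at hx

theorem exists_sylow_eq (hG : IsVirtuallyToral p G) {X : Subgroup G} (hX : IsPGroup p X)
    (hmax : ∀ Y : Subgroup G, IsPGroup p Y → X ≤ Y → Y ≤ Subgroup.normalizer (X : Set G) → Y ≤ X) :
    ∃ P : Sylow p G, (P : Subgroup G) = X := by
  obtain ⟨P, hXP⟩ := hX.exists_le_sylow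
  refine ⟨P, le_antisymm (Subgroup.subgroupOf_eq_top.1 ?_) hXP⟩
  have hN := hG.normalizerCondition_of_injective (P : Subgroup G).subtype_injective P.isPGroup'
  refine normalizerCondition_iff_only_full_group_self_normalizing.1 hN _
    (le_antisymm ?_ Subgroup.le_normalizer)
  rintro ⟨y, hyP⟩ hy
  rw [← Subgroup.subgroupOf_normalizer_eq hXP] at hy
  exact hmax (P ⊓ Subgroup.normalizer (X : Set G)) (P.isPGroup'.to_le inf_le_left)
    (le_inf hXP Subgroup.le_normalizer) inf_le_right ⟨hyP, hy⟩

end IsVirtuallyToral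

end VirtuallyToral

namespace PartialGroup

variable {L : Type u} [PartialGroup L]

theorem conjTo_inv_iff {g x y : L} : ConjTo g⁻¹ y x ↔ ConjTo g x y :=
  ⟨fun h => invol g ▸ h.symm, ConjTo.symm⟩

theorem ConjTo.inv {g x y : L} (h : ConjTo g x y) : ConjTo g x⁻¹ y⁻¹ := by
  obtain ⟨hD, rfl⟩ := h
  exact ⟨by simpa [winv, invol] using winv_mem hD, by simpa [winv, invol] using prod_winv hD⟩

theorem ConjTo.prod_eq {g x y : L} (h : ConjTo g x y) : prod [x, g] = prod [g, y] := by
  obtain ⟨hD, rfl⟩ := h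
  have hW : [g, g⁻¹, x, g] ∈ (D : Set (List L)) :=
    right_mem [g⁻¹, x⁻¹] _ (by simpa [winv, invol] using winv_append_mem hD)
  have hcancel := (same_cancel [] g [x, g] hW).2
  have hcontract := (same_contract [g] [g⁻¹, x, g] [] (by simpa using hW)).2
  exact hcancel.symm.trans hcontract

theorem ConjTo.comp {g h x y z : L} (hW : [h⁻¹, g⁻¹, x, g, h] ∈ (D : Set (List L)))
    (hxy : ConjTo g x y) (hyz : ConjTo h y z) : ConjTo (prod [g, h]) x z := by
  have hinv : prod [h⁻¹, g⁻¹] = (prod [g, h])⁻¹ := by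
    simpa [winv] using prod_winv (right_mem [h⁻¹, g⁻¹, x] [g, h] hW)
  have hboth := ((same_contract [] [h⁻¹, g⁻¹] [x, g, h]).trans
    (same_contract [prod [h⁻¹, g⁻¹], x] [g, h] [])) hW
  have hmid := (same_contract [h⁻¹] [g⁻¹, x, g] [h] hW).2
  simp only [List.nil_append, List.append_nil, List.cons_append, hinv, hxy.2, hyz.2] at hboth hmid
  exact ⟨hboth.1, hboth.2.symm.trans hmid⟩

theorem ConjTo.mul {g x y x' y' : L} (hW : [g⁻¹, x, g, g⁻¹, x', g] ∈ (D : Set (List L)))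
    (h : ConjTo g x y) (h' : ConjTo g x' y') : ConjTo g (prod [x, x']) (prod [y, y']) := by
  have hcancel := (same_cancel [g⁻¹, x] g [x', g]).trans (same_contract [g⁻¹] [x, x'] [g]) hW
  have hcontract := ((same_contract [] [g⁻¹, x, g] [g⁻¹, x', g]).trans
    (same_contract [prod [g⁻¹, x, g]] [g⁻¹, x', g] []) hW).2
  simp only [List.nil_append, List.append_nil, List.cons_append, h.2, h'.2] at hcancel hcontract
  exact ⟨hcancel.1, hcancel.2.symm.trans hcontract⟩

end PartialGroup

namespace PSubgroup

open PartialGroup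

variable {L : Type u} [PartialGroup L]

theorem coe_list_prod (H : PSubgroup L) (w : List H) :
    ((w.prod : H) : L) = prod (w.map ((↑) : H → L)) := by
  induction w with
  | nil => rfl
  | cons a w ih =>
    have hD : (a :: w).map ((↑) : H → L) ∈ (D : Set (List L)) := H.word_mem _ fun g hg => by
      obtain ⟨b, -, rfl⟩ := List.mem_map.1 hg
      exact b.2
    have h := contract_prod [(a : L)] (w.map (↑)) [] (by simpa using hD)
    simp only [List.append_nil, List.cons_append, List.nil_append] at h
    rw [List.prod_cons, coe_mul, ih, List.map_cons, h]

/-- A subgroup of the group `H ≤ L`, regarded as a subgroup of the partial group `L`. -/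
def ofSubgroup {H : PSubgroup L} (X : Subgroup H) : PSubgroup L where
  carrier := (↑) '' (X : Set H)
  word_mem w hw := H.word_mem w fun g hg => by
    obtain ⟨x, -, rfl⟩ := hw g hg
    exact x.2
  prod_mem w hw := by
    obtain ⟨v, rfl⟩ : w ∈ Set.range (List.map fun x : X => ((x : H) : L)) := by
      rw [Set.range_list_map]
      intro g hg
      obtain ⟨x, hx, rfl⟩ := hw g hg
      exact ⟨⟨x, hx⟩, rfl⟩
    refine ⟨((v.prod : X) : H), v.prod.2, ?_⟩
    rw [Subgroup.val_list_prod, coe_list_prod, List.map_map]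
    rfl
  inv_mem := by
    rintro _ ⟨x, hx, rfl⟩
    exact ⟨x⁻¹, X.inv_mem hx, rfl⟩

theorem isPGroup_ofSubgroup {p : ℕ} {H : PSubgroup L} {X : Subgroup H} (hX : IsPGroup p X) :
    IsPGroup p (ofSubgroup X) := by
  have hsurj : Function.Surjective (fun x : X => (⟨x, x, x.2, rfl⟩ : ofSubgroup X)) := by
    rintro ⟨_, x, hx, rfl⟩
    exact ⟨⟨x, hx⟩, rfl⟩
  exact hX.of_surjective (MonoidHom.mk' _ fun _ _ => rfl) hsurj

/-- The intersection `X ∩ H` of two subgroups of `L`, as a subgroup of the group `H`. -/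
def subgroupOf (X H : PSubgroup L) : Subgroup H where
  carrier := {h | (h : L) ∈ X}
  one_mem' := X.prod_mem [] (by simp)
  mul_mem' ha hb := X.mul_mem ha hb
  inv_mem' ha := X.inv_mem _ ha

theorem isPGroup_subgroupOf {p : ℕ} {X : PSubgroup L} (hX : IsPGroup p X) (H : PSubgroup L) :
    IsPGroup p (X.subgroupOf H) :=
  hX.of_injective (MonoidHom.mk' (fun x => (⟨((x : H) : L), x.2⟩ : X)) fun _ _ => rfl)
    fun _ _ h => Subtype.ext (Subtype.ext (congrArg Subtype.val h :))

end PSubgroup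

section Conjugation

open PartialGroup

variable {L : Type u} [PartialGroup L] {S : PSubgroup L} {P Q R : Subgroup S} {g : L}

theorem conjEq_unit (P : Subgroup S) : ConjEq P unit P :=
  ⟨fun x hx => ⟨x, hx, conjTo_unit _⟩, fun x hx => ⟨x, hx, conjTo_unit _⟩⟩

theorem conjEq_iff_transp : ConjEq P g Q ↔ g ∈ Transp P Q ∧ g⁻¹ ∈ Transp Q P := by
  simp only [ConjEq, Transp, Set.mem_ofPred_eq, conjTo_inv_iff]

theorem transp_mono {P' Q' : Subgroup S} (hP : P' ≤ P) (hQ : Q ≤ Q') :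
    (Transp P Q : Set L) ⊆ Transp P' Q' := fun _ h x hx =>
  let ⟨y, hy, hxy⟩ := h x (hP hx)
  ⟨y, hQ hy, hxy⟩

theorem ConjEq.mem_iff (h : ConjEq P g Q) {x y : S} (hxy : ConjTo g (x : L) (y : L)) :
    x ∈ P ↔ y ∈ Q := by
  constructor
  · intro hx
    obtain ⟨z, hz, hxz⟩ := h.1 x hx
    rwa [Subtype.ext (hxy.eq hxz)]
  · intro hy
    obtain ⟨z, hz, hzy⟩ := h.2 y hy
    rwa [Subtype.ext (hxy.inj hzy)]

theorem ConjEq.le_of_transp (h : ConjEq P g Q) (hR : g ∈ Transp P R) : Q ≤ R := by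
  intro y hy
  obtain ⟨x, hx, hxy⟩ := h.2 y hy
  obtain ⟨z, hz, hxz⟩ := hR x hx
  rwa [Subtype.ext (hxy.eq hxz)]

theorem ConjEq.unique (h : ConjEq P g Q) (k : ConjEq P g R) : Q = R :=
  le_antisymm (h.le_of_transp k.1) (k.le_of_transp h.1)

theorem ConjEq.le_iff_le {P' Q' : Subgroup S} (h : ConjEq P g Q) (h' : ConjEq P' g Q') :
    P ≤ P' ↔ Q ≤ Q' := by
  refine ⟨fun hle => h.le_of_transp (transp_mono hle le_rfl h'.1), fun hle x hx => ?_⟩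
  obtain ⟨y, hy, hxy⟩ := h.1 x hx
  exact (h'.mem_iff hxy).2 (hle hy)

theorem conjEq_coe_iff {s : S} : ConjEq P (s : L) P ↔ s ∈ Subgroup.normalizer (P : Set S) := by
  rw [Subgroup.mem_normalizer_iff'']
  refine ⟨fun h x => h.mem_iff (S.conjTo_coe s x), fun h => ?_⟩
  convert conjEq_conjSub P s using 1
  ext z
  rw [mem_conjSub]
  exact ⟨fun hz => ⟨s * z * s⁻¹, (h _).2 (by convert hz using 1; group), by group⟩,
    fun ⟨x, hx, hxz⟩ => hxz ▸ (h x).1 hx⟩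

end Conjugation

namespace PreLocality

open PartialGroup

variable {p : ℕ} {L : Type u} [PartialGroup L] (M : PreLocality p L)
  {P Q R : Subgroup M.S} {g h x y z : L}

theorem mem_Δ_of_conjEq (hg : ConjEq P g Q) (hP : P ∈ M.Δ) : Q ∈ M.Δ :=
  M.closed P Q g hP hg.1

theorem via_cons {w : List L} (hg : ConjEq P g Q) (hw : Via M.Δ w Q) : Via M.Δ (g :: w) P :=
  ⟨M.mem_Δ_of_conjEq hg.symm hw.mem, Q, hg, hw⟩

theorem mem_D_of_via {w : List L} (hw : Via M.Δ w P) : w ∈ (D : Set (List L)) :=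
  (M.mem_D_iff w).2 ⟨P, hw⟩

theorem conjEq_comp (hP : P ∈ M.Δ) (hg : ConjEq P g Q) (hh : ConjEq Q h R) :
    ConjEq P (prod [g, h]) R := by
  refine ⟨M.trans_mul hP hg.1 hh.1, fun z hz => ?_⟩
  obtain ⟨y, hy, hyz⟩ := hh.2 z hz
  obtain ⟨x, hx, hxy⟩ := hg.2 y hy
  exact ⟨x, hx, M.conjTo_comp hP hg.1 hh.1 hx hxy hyz⟩

theorem conjTo_of_normalizes (hP : P ∈ M.Δ) (hg : ConjEq P g Q) (hx : ConjEq P x P) :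
    ConjTo g x (prod [g⁻¹, x, g]) :=
  ⟨M.mem_D_of_via (M.via_cons hg.symm (M.via_cons hx
    (M.via_cons hg (M.mem_Δ_of_conjEq hg hP)))), rfl⟩

theorem conjEq_of_conjTo (hP : P ∈ M.Δ) (hg : ConjEq P g Q) (hx : ConjEq P x P)
    (hxy : ConjTo g x y) : ConjEq Q y Q := by
  have hQ := M.mem_Δ_of_conjEq hg hP
  have hcontract : y = prod [prod [g⁻¹, x], g] :=
    hxy.2.symm.trans (contract_prod [] [g⁻¹, x] [g] hxy.1)
  exact hcontract ▸ M.conjEq_comp hQ (M.conjEq_comp hQ hg.symm hx) hg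

theorem conjTo_comp_of_normalizes (hP : P ∈ M.Δ) (hg : ConjEq P g Q) (hh : ConjEq Q h R)
    (hx : ConjEq P x P) (hxy : ConjTo g x y) (hyz : ConjTo h y z) :
    ConjTo (prod [g, h]) x z := by
  have hR := M.mem_Δ_of_conjEq hh (M.mem_Δ_of_conjEq hg hP)
  exact hxy.comp (M.mem_D_of_via (M.via_cons hh.symm (M.via_cons hg.symm (M.via_cons hx
    (M.via_cons hg (M.via_cons hh hR)))))) hyz

/-- Conjugation by `g` as an isomorphism `N_L(P) ≃* N_L(P ^ g)`. -/
def conjNormalizer (hP : P ∈ M.Δ) (hQ : Q ∈ M.Δ) (hg : ConjEq P g Q) :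
    M.normalizer P hP ≃* M.normalizer Q hQ where
  toFun x := ⟨prod [g⁻¹, (x : L), g],
    M.conjEq_of_conjTo hP hg x.2 (M.conjTo_of_normalizes hP hg x.2)⟩
  invFun y := ⟨prod [g⁻¹⁻¹, (y : L), g⁻¹],
    M.conjEq_of_conjTo hQ hg.symm y.2 (M.conjTo_of_normalizes hQ hg.symm y.2)⟩
  left_inv x := Subtype.ext (M.conjTo_of_normalizes hP hg x.2).symm.2
  right_inv y := Subtype.ext (conjTo_inv_iff.1 (M.conjTo_of_normalizes hQ hg.symm y.2)).2
  map_mul' x y := Subtype.ext <|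
    ((M.conjTo_of_normalizes hP hg x.2).mul (M.mem_D_of_via (M.via_cons hg.symm
      (M.via_cons x.2 (M.via_cons hg (M.via_cons hg.symm (M.via_cons y.2
        (M.via_cons hg hQ))))))) (M.conjTo_of_normalizes hP hg y.2)).2

theorem conjTo_conjNormalizer (hP : P ∈ M.Δ) (hQ : Q ∈ M.Δ) (hg : ConjEq P g Q)
    (x : M.normalizer P hP) : ConjTo g (x : L) (M.conjNormalizer hP hQ hg x : L) :=
  M.conjTo_of_normalizes hP hg x.2

end PreLocality

namespace PreLocality

open PartialGroup

variable {p : ℕ} {L : Type u} [PartialGroup L] (M : PreLocality p L) {P Q R : Subgroup M.S} {g : L}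

/-- The subgroup of all `x ∈ S` for which `x ^ g` is defined and lies in `Q`. -/
def conjComap (g : L) (Q : Subgroup M.S) : Subgroup M.S where
  carrier := {x | ∃ y ∈ Q, ConjTo g (x : L) (y : L)}
  one_mem' := ⟨1, Q.one_mem, M.conjTo_one g⟩
  mul_mem' := fun ⟨y, hy, hxy⟩ ⟨y', hy', hxy'⟩ =>
    ⟨y * y', Q.mul_mem hy hy', M.conjTo_mul hxy hxy'⟩
  inv_mem' := fun ⟨y, hy, hxy⟩ => ⟨y⁻¹, Q.inv_mem hy, hxy.inv⟩

theorem mem_transp_iff_le_conjComap : g ∈ Transp P Q ↔ P ≤ M.conjComap g Q := Iff.rfl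

/-- The subgroup `S_w` of `S`. -/
def domain : List L → Subgroup M.S
  | [] => ⊤
  | g :: w => M.conjComap g (domain w)

theorem inS_iff_mem_domain {w : List L} {x : M.S} : InS M.S w x ↔ x ∈ M.domain w := by
  induction w generalizing x with
  | nil => exact iff_of_true x.2 trivial
  | cons g w ih =>
    constructor
    · rintro ⟨-, y, hxy, hy⟩
      have hyS : y ∈ M.S := by cases w with | nil => exact hy | cons => exact hy.1
      exact ⟨⟨y, hyS⟩, ih.1 hy, hxy⟩
    · rintro ⟨y, hy, hxy⟩
      exact ⟨x.2, y, hxy, ih.2 hy⟩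

/-- The closure operator on subgroups of `S` whose closed subgroups are the members of the poset
`Ω_S(L)`, i.e. the intersections of subgroups `S_w`. -/
def closure : ClosureOperator (Subgroup M.S) :=
  .mk' (fun P => ⨅ w, ⨅ _ : P ≤ M.domain w, M.domain w)
    (fun _ _ hPQ => le_iInf₂ fun w hw => iInf₂_le w (hPQ.trans hw))
    (fun _ => le_iInf₂ fun _ hw => hw)
    (fun _ => le_iInf₂ fun w hw => iInf₂_le w (iInf₂_le w hw))

theorem closure_le_domain {w : List L} (hP : P ≤ M.domain w) : M.closure P ≤ M.domain w :=
  iInf₂_le w hP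

theorem mem_closure_iff {x : M.S} :
    x ∈ M.closure P ↔ ∀ w, P ≤ M.domain w → x ∈ M.domain w := by
  change x ∈ ⨅ w, ⨅ _ : P ≤ M.domain w, M.domain w ↔ _
  simp only [Subgroup.mem_iInf]

theorem transp_closure (hg : g ∈ Transp P Q) : g ∈ Transp (M.closure P) (M.closure Q) := by
  intro x hx
  obtain ⟨y, -, hxy⟩ : x ∈ M.conjComap g ⊤ :=
    M.closure_le_domain (w := [g]) (transp_mono le_rfl le_top hg) hx
  refine ⟨y, M.mem_closure_iff.2 fun w hw => ?_, hxy⟩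
  obtain ⟨z, hz, hxz⟩ : x ∈ M.conjComap g (M.domain w) :=
    M.closure_le_domain (w := g :: w) (transp_mono le_rfl hw hg) hx
  rwa [Subtype.ext (hxy.eq hxz)]

theorem conjEq_closure (h : ConjEq P g Q) : ConjEq (M.closure P) g (M.closure Q) :=
  conjEq_iff_transp.2 ⟨M.transp_closure h.1, M.transp_closure h.symm.1⟩

theorem isClosed_of_conjEq (h : ConjEq P g Q) (hP : M.closure.IsClosed P) :
    M.closure.IsClosed Q := by
  have hclosure := M.conjEq_closure h
  rw [hP.closure_eq] at hclosure
  exact M.closure.isClosed_iff.2 (hclosure.unique h)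

theorem image_closed_mem_Omega (A : M.closure.Closeds) :
    (↑) '' ((A : Subgroup M.S) : Set M.S) ∈ M.Omega := by
  refine ⟨{w | A ≤ M.domain w}, ⟨[], fun _ _ => trivial⟩, Set.ext fun x => ⟨?_, fun hx => ?_⟩⟩
  · rintro ⟨x, hx, rfl⟩ w hw
    exact M.inS_iff_mem_domain.2 (hw hx)
  · have hxS : x ∈ M.S := hx [] fun _ _ => trivial
    refine ⟨⟨x, hxS⟩, ?_, rfl⟩
    rw [← A.2.closure_eq]
    exact M.mem_closure_iff.2 fun w hw => M.inS_iff_mem_domain.1 (hx w hw)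

/-- The closed subgroups of `S` as elements of the poset `Ω_S(L)`. -/
def closedsToOmega (A : M.closure.Closeds) : M.Omega := ⟨_, M.image_closed_mem_Omega A⟩

theorem closedsToOmega_strictMono : StrictMono M.closedsToOmega :=
  strictMono_of_le_iff_le fun _ _ => (Set.image_subset_image_iff Subtype.val_injective).symm

theorem height_le_of_conjEq {A B : M.closure.Closeds} (h : ConjEq A.1 g B.1) :
    Order.height A ≤ Order.height B := by
  have hC : ∀ C : Set.Iic A, g ∈ Transp C.1.1 B.1 := fun C => transp_mono C.2 le_rfl h.1
  let conj (C : Set.Iic A) : Set.Iic B :=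
    ⟨⟨M.image g (hC C), M.isClosed_of_conjEq (M.conjEq_image g (hC C)) C.1.2⟩, M.image_le g (hC C)⟩
  have hconj : StrictMono conj := strictMono_of_le_iff_le fun C C' =>
    (M.conjEq_image g (hC C)).le_iff_le (M.conjEq_image g (hC C'))
  have := Order.krullDim_le_of_strictMono conj hconj
  rwa [← Order.height_eq_krullDim_Iic, ← Order.height_eq_krullDim_Iic, WithBot.coe_le_coe] at this

end PreLocality

namespace Locality

open PartialGroup

variable {p : ℕ} {L : Type u} [PartialGroup L] (M : Locality p L) {P Q : Subgroup M.S} {g : L}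

theorem exists_height_closed_le : ∃ n : ℕ, ∀ A : M.closure.Closeds, Order.height A ≤ n := by
  obtain ⟨n, hn⟩ := M.finiteDim
  refine ⟨n, fun A => ?_⟩
  have hOmega : Order.krullDim M.Omega ≤ n := iSup_le fun s => by exact_mod_cast hn s
  exact_mod_cast (Order.height_le_krullDim A).trans
    ((Order.krullDim_le_of_strictMono _ M.closedsToOmega_strictMono).trans hOmega)

/-- The dimension of `P ≤ S`: the height of the closure of `P` in the poset of closed subgroups.
This is finite, so nothing is lost in passing to `ℕ`. -/
noncomputable def dim (P : Subgroup M.S) : ℕ := (Order.height (M.closure.toCloseds P)).toNat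

theorem coe_dim (P : Subgroup M.S) : (M.dim P : ℕ∞) = Order.height (M.closure.toCloseds P) := by
  obtain ⟨n, hn⟩ := M.exists_height_closed_le
  exact ENat.natCast_toNat (ne_top_of_le_ne_top (ENat.natCast_ne_top n) (hn _))

theorem exists_dim_le : ∃ n, ∀ P, M.dim P ≤ n := by
  obtain ⟨n, hn⟩ := M.exists_height_closed_le
  exact ⟨n, fun P => by exact_mod_cast M.coe_dim P ▸ hn _⟩

theorem dim_lt_dim (h : M.closure P < M.closure Q) : M.dim P < M.dim Q := by
  have hlt := Order.height_strictMono (show M.closure.toCloseds P < M.closure.toCloseds Q from h)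
    (M.coe_dim P ▸ ENat.natCast_lt_top _)
  rw [← coe_dim, ← coe_dim] at hlt
  exact_mod_cast hlt

theorem dim_eq_of_conjEq (h : ConjEq P g Q) : M.dim P = M.dim Q :=
  congrArg ENat.toNat <| le_antisymm (M.height_le_of_conjEq (M.conjEq_closure h))
    (M.height_le_of_conjEq (M.conjEq_closure h.symm))

theorem dim_closure (P : Subgroup M.S) : M.dim (M.closure P) = M.dim P := by
  have : M.closure.toCloseds (M.closure P) = M.closure.toCloseds P :=
    Subtype.ext (M.closure.idempotent P)
  rw [dim, this, dim]

theorem closure_eq_of_le_of_dim_le (h : P ≤ Q) (hd : M.dim Q ≤ M.dim P) :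
    M.closure P = M.closure Q :=
  eq_of_le_of_not_lt (M.closure.monotone h) fun hlt => (M.dim_lt_dim hlt).not_ge hd

end Locality

namespace PreLocality

open PartialGroup PSubgroup

variable {p : ℕ} {L : Type u} [PartialGroup L] (M : PreLocality p L) {Q R : Subgroup M.S} {g : L}

/-- `Q` absorbs `p`-subgroups if every `p`-subgroup of `L` that normalizes `Q` is conjugated into
`S` by some element of `L` that conjugates `Q` into `S` as well. -/
def Absorbs (Q : Subgroup M.S) : Prop :=
  ∀ X : PSubgroup L, IsPGroup p X → (∀ x ∈ X, ConjEq Q x Q) →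
    ∃ h ∈ Transp Q (⊤ : Subgroup M.S), ∀ x ∈ X, ∃ y ∈ M.S, ConjTo h x y

variable {M}

theorem Absorbs.of_closure (h : M.Absorbs (M.closure Q)) : M.Absorbs Q := by
  intro X hX hXQ
  obtain ⟨k, hk, hXk⟩ := h X hX fun x hx => M.conjEq_closure (hXQ x hx)
  exact ⟨k, transp_mono (M.closure.le_closure Q) le_rfl hk, hXk⟩

theorem Absorbs.of_conjEq (hQ : Q ∈ M.Δ) (hg : ConjEq Q g R) (h : M.Absorbs R) :
    M.Absorbs Q := by
  intro X hX hXQ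
  have hR := M.mem_Δ_of_conjEq hg hQ
  let c := M.conjNormalizer hQ hR hg
  have hXR : IsPGroup p (ofSubgroup ((X.subgroupOf (M.normalizer Q hQ)).map c.toMonoidHom)) :=
    isPGroup_ofSubgroup ((isPGroup_subgroupOf hX _).map _)
  obtain ⟨k, hk, hXk⟩ := h _ hXR (by rintro _ ⟨x, -, rfl⟩; exact x.2)
  refine ⟨prod [g, k], M.trans_mul hQ hg.1 hk, fun x hx => ?_⟩
  let x' : M.normalizer Q hQ := ⟨x, hXQ x hx⟩
  obtain ⟨y, hy, hxy⟩ := hXk (c x') ⟨_, ⟨x', hx, rfl⟩, rfl⟩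
  exact ⟨y, hy, M.conjTo_comp_of_normalizes hQ hg (M.conjEq_image k hk) (hXQ x hx)
    (M.conjTo_conjNormalizer hQ hR hg x') hxy⟩

theorem Absorbs.of_sylow [Fact p.Prime] (hQ : Q ∈ M.Δ)
    (hG : IsVirtuallyToral p (M.normalizer Q hQ)) (P : Sylow p (M.normalizer Q hQ))
    (hP : (P : Subgroup (M.normalizer Q hQ)) = M.S.subgroupOf (M.normalizer Q hQ)) :
    M.Absorbs Q := by
  intro X hX hXQ
  obtain ⟨k, hk⟩ := hG.exists_conj_le_sylow (isPGroup_subgroupOf hX _) P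
  refine ⟨k, transp_mono le_rfl le_top k.2.1, fun x hx => ?_⟩
  have hxk := hk ⟨x, hXQ x hx⟩ hx
  rw [← SetLike.mem_coe, ← Sylow.coe_coe, hP] at hxk
  exact ⟨_, hxk, conjTo_coe _ k ⟨x, hXQ x hx⟩⟩

theorem transp_normalizer (hQ : Q ∈ M.Δ) {x : M.normalizer Q hQ}
    (hx : x ∈ Subgroup.normalizer (M.S.subgroupOf (M.normalizer Q hQ) : Set _)) :
    (x : L) ∈ Transp (Subgroup.normalizer (Q : Set M.S)) (Subgroup.normalizer (Q : Set M.S)) := by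
  intro r hr
  let r' : M.normalizer Q hQ := ⟨r, conjEq_coe_iff.2 hr⟩
  have hS : x⁻¹ * r' * x ∈ M.S.subgroupOf _ := (Subgroup.mem_normalizer_iff''.1 hx r').1 r.2
  exact ⟨⟨_, hS⟩, conjEq_coe_iff.1 (x⁻¹ * r' * x).2, conjTo_coe _ x r'⟩

theorem conjEq_normalizer (hQ : Q ∈ M.Δ) {x : M.normalizer Q hQ}
    (hx : x ∈ Subgroup.normalizer (M.S.subgroupOf (M.normalizer Q hQ) : Set _)) :
    ConjEq (Subgroup.normalizer (Q : Set M.S)) (x : L) (Subgroup.normalizer (Q : Set M.S)) :=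
  conjEq_iff_transp.2 ⟨transp_normalizer hQ hx, transp_normalizer hQ (inv_mem hx)⟩

theorem le_normalizer_of_conjEq {Q' R' : Subgroup M.S} (hQ : Q ∈ M.Δ)
    (hg : ConjEq Q g Q') (hR : R ≤ Subgroup.normalizer (Q : Set M.S)) (hR' : ConjEq R g R') :
    R' ≤ Subgroup.normalizer (Q' : Set M.S) := by
  intro y hy
  obtain ⟨r, hr, hry⟩ := hR'.2 y hy
  exact conjEq_coe_iff.1 (M.conjEq_of_conjTo hQ hg (conjEq_coe_iff.2 (hR hr)) hry)

variable (M) in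
/-- The inclusion of `S` into `N_L(S)`. -/
def toNormalizerTop : M.S →* M.normalizer ⊤ M.top_mem :=
  MonoidHom.mk' (fun s => ⟨s, conjEq_self (Subgroup.mem_top s)⟩) fun _ _ => rfl

theorem toNormalizerTop_injective : Function.Injective M.toNormalizerTop := fun _ _ h =>
  Subtype.ext (congrArg Subtype.val h :)

theorem subgroupOf_normalizer_top_normal :
    (M.S.subgroupOf (M.normalizer ⊤ M.top_mem)).Normal := by
  refine ⟨fun s hs g => ?_⟩
  obtain ⟨y, -, hy⟩ := (g⁻¹).2.1 ⟨s, hs⟩ trivial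
  have hconj := conjTo_coe _ g⁻¹ s
  rw [inv_inv] at hconj
  exact (hconj.eq hy ▸ y.2 : ((g * s * g⁻¹ : M.normalizer ⊤ M.top_mem) : L) ∈ M.S)

end PreLocality

namespace Locality

open PartialGroup PSubgroup PreLocality

variable {p : ℕ} {L : Type u} [PartialGroup L] (M : Locality p L) {P Q : Subgroup M.S} {g : L}

theorem absorbs_top : M.Absorbs ⊤ := by
  intro X hX hXS
  let N := M.normalizer ⊤ M.top_mem
  have := M.subgroupOf_normalizer_top_normal
  have hXS_isPGroup : IsPGroup p (X.subgroupOf N ⊔ M.S.subgroupOf N : Subgroup N) :=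
    (isPGroup_subgroupOf hX N).to_sup_of_normal_right (isPGroup_subgroupOf M.isPGroup N)
  have hS := M.maximal (ofSubgroup (X.subgroupOf N ⊔ M.S.subgroupOf N))
    (fun s hs => ⟨M.toNormalizerTop ⟨s, hs⟩, le_sup_right (a := X.subgroupOf N) hs, rfl⟩)
    (isPGroup_ofSubgroup hXS_isPGroup)
  refine ⟨unit, M.unit_mem_trans le_top, fun x hx => ⟨x, ?_, conjTo_unit x⟩⟩
  rw [← hS]
  exact ⟨⟨x, hXS x hx⟩, le_sup_left (b := M.S.subgroupOf N) hx, rfl⟩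

/-- `Q` is fully normalized if the dimension of `N_S(Q)` is maximal among the conjugates of `Q`. -/
def IsFullyNormalized (Q : Subgroup M.S) : Prop :=
  ∀ (g : L) (Q' : Subgroup M.S), ConjEq Q g Q' →
    M.dim (Subgroup.normalizer (Q' : Set M.S)) ≤ M.dim (Subgroup.normalizer (Q : Set M.S))

theorem exists_conjEq_isFullyNormalized (hP : P ∈ M.Δ) :
    ∃ (g : L) (Q : Subgroup M.S), ConjEq P g Q ∧ M.IsFullyNormalized Q := by
  let dims := (fun Q : Subgroup M.S => M.dim (Subgroup.normalizer (Q : Set M.S))) ''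
    {Q | ∃ g : L, ConjEq P g Q}
  have hbdd : BddAbove dims := by
    obtain ⟨n, hn⟩ := M.exists_dim_le
    exact ⟨n, Set.forall_mem_image.2 fun _ _ => hn _⟩
  obtain ⟨Q, ⟨g, hg⟩, hQ⟩ := Nat.sSup_mem (s := dims) ⟨_, P, ⟨unit, conjEq_unit P⟩, rfl⟩ hbdd
  refine ⟨g, Q, hg, fun h Q' hh => ?_⟩
  exact (le_csSup hbdd ⟨Q', ⟨_, M.conjEq_comp hP hg hh⟩, rfl⟩).trans_eq hQ.symm

/- Let `Y ≥ N_S(Q)` be a `p`-subgroup of `N_L(Q)` normalizing `N_S(Q)`. Some `h` conjugates `Y` into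
`N_S(Q ^ h)`. By maximality of the dimension, `N_S(Q ^ h)` lies in the closure of `N_S(Q) ^ h`, on
which `h⁻¹` is defined with values in `S`. Hence `Y ≤ S`. -/
theorem IsFullyNormalized.exists_sylow_eq [Fact p.Prime] (hfn : M.IsFullyNormalized Q)
    (hQ : Q ∈ M.Δ) (hG : IsVirtuallyToral p (M.normalizer Q hQ))
    (hR : M.Absorbs (Subgroup.normalizer (Q : Set M.S))) :
    ∃ P : Sylow p (M.normalizer Q hQ),
      (P : Subgroup (M.normalizer Q hQ)) = M.S.subgroupOf (M.normalizer Q hQ) := by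
  refine hG.exists_sylow_eq (isPGroup_subgroupOf M.isPGroup _) fun Y hY _ hYN y hy => ?_
  obtain ⟨h, hh, hYh⟩ := hR (ofSubgroup Y) (isPGroup_ofSubgroup hY) (by
    rintro _ ⟨z, hz, rfl⟩
    exact conjEq_normalizer hQ (hYN hz))
  have hhQ : h ∈ Transp Q ⊤ := transp_mono Subgroup.le_normalizer le_rfl hh
  have hQh := M.conjEq_image h hhQ
  have hNh := M.conjEq_image h hh
  have hclosure := M.closure_eq_of_le_of_dim_le (le_normalizer_of_conjEq hQ hQh le_rfl hNh)
    ((hfn h _ hQh).trans_eq (M.dim_eq_of_conjEq hNh))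
  obtain ⟨z, hz, hyz⟩ := hYh y ⟨y, hy, rfl⟩
  have hzN : (⟨z, hz⟩ : M.S) ∈ Subgroup.normalizer (M.image h hhQ : Set M.S) :=
    conjEq_coe_iff.1 (M.conjEq_of_conjTo hQ hQh y.2 hyz)
  obtain ⟨s, -, hsz⟩ := (M.conjEq_closure hNh).2 ⟨z, hz⟩
    (hclosure ▸ M.closure.le_closure _ hzN)
  exact (hyz.inj hsz ▸ s.2 : (y : L) ∈ M.S)

variable [Fact p.Prime]
  (htoral : ∀ (P : Subgroup M.S) (hP : P ∈ M.Δ), IsVirtuallyToral p (M.normalizer P hP))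

include htoral

theorem normalizerCondition : NormalizerCondition M.S :=
  (htoral ⊤ M.top_mem).normalizerCondition_of_injective M.toNormalizerTop_injective M.isPGroup

theorem dim_lt_dim_normalizer (hQ : M.closure.IsClosed Q) (htop : Q ≠ ⊤) :
    M.dim Q < M.dim (Subgroup.normalizer (Q : Set M.S)) :=
  M.dim_lt_dim <| hQ.closure_eq.symm ▸
    ((M.normalizerCondition htoral Q (lt_top_iff_ne_top.2 htop)).trans_le (M.closure.le_closure _))

theorem absorbs (hQ : Q ∈ M.Δ) : M.Absorbs Q := by
  obtain ⟨n, hn⟩ := M.exists_dim_le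
  induction hm : n - M.dim Q using Nat.strong_induction_on generalizing Q with
  | _ m ih =>
  have hQcl : M.closure Q ∈ M.Δ := M.mem_of_le hQ (M.closure.le_closure Q)
  obtain ⟨g, R, hg, hfn⟩ := M.exists_conjEq_isFullyNormalized hQcl
  have hR : R ∈ M.Δ := M.mem_Δ_of_conjEq hg hQcl
  refine .of_closure (.of_conjEq hQcl hg ?_)
  by_cases htop : R = ⊤
  · exact htop ▸ M.absorbs_top
  have hdim : M.dim Q < M.dim (Subgroup.normalizer (R : Set M.S)) := by
    rw [← M.dim_closure Q, M.dim_eq_of_conjEq hg]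
    exact M.dim_lt_dim_normalizer htoral
      (M.isClosed_of_conjEq hg (M.closure.isClosed_closure Q)) htop
  have hN : M.Absorbs (Subgroup.normalizer (R : Set M.S)) := by
    have := hn (Subgroup.normalizer (R : Set M.S))
    exact ih _ (by omega) (M.mem_of_le hR Subgroup.le_normalizer) rfl
  obtain ⟨P, hP⟩ := hfn.exists_sylow_eq M hR (htoral R hR) hN
  exact .of_sylow hR (htoral R hR) P hP

theorem exists_conjEq_sylow (hP : P ∈ M.Δ) :
    ∃ (g : L) (Q : Subgroup M.S) (hQ : Q ∈ M.Δ), ConjEq P g Q ∧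
      ∃ T : Sylow p (M.normalizer Q hQ),
        (T : Subgroup (M.normalizer Q hQ)) = M.S.subgroupOf (M.normalizer Q hQ) := by
  obtain ⟨g, Q, hg, hfn⟩ := M.exists_conjEq_isFullyNormalized hP
  have hQ := M.mem_Δ_of_conjEq hg hP
  exact ⟨g, Q, hQ, hg, hfn.exists_sylow_eq M hQ (htoral Q hQ)
    (M.absorbs htoral (M.mem_of_le hQ Subgroup.le_normalizer))⟩

/-- The argument takes place in `N_L(P)` for the closure of `P`, where powers of `g` reach `g⁻¹`. -/
theorem conjEq_of_transp (hP : P ∈ M.Δ) (hg : g ∈ Transp P P) : ConjEq P g P := by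
  have himage := M.conjEq_image g hg
  have hclosure : M.closure (M.image g hg) = M.closure P :=
    M.closure_eq_of_le_of_dim_le (M.image_le g hg) (M.dim_eq_of_conjEq himage).le
  let N := M.normalizer (M.closure P) (M.mem_of_le hP (M.closure.le_closure P))
  have hγN : ConjEq (M.closure P) g (M.closure P) := by
    simpa only [hclosure] using M.conjEq_closure himage
  let γ : N := ⟨g, hγN⟩
  let transporters : Submonoid N :=
    { carrier := {x | (x : L) ∈ Transp P P}
      one_mem' := M.unit_mem_trans le_rfl
      mul_mem' := fun hx hy => M.trans_mul hP hx hy }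
  have hγ : IsOfFinOrder γ := (htoral _ _).isOfFinOrder γ
  have hinv : γ⁻¹ ∈ transporters :=
    Submonoid.powers_le.2 (show γ ∈ transporters from hg)
      (hγ.mem_powers_iff_mem_zpowers.2 (inv_mem (Subgroup.mem_zpowers γ)))
  exact conjEq_iff_transp.2 ⟨hg, hinv⟩

end Locality

namespace PreLocality

open CategoryTheory PartialGroup PSubgroup

variable {p : ℕ} {L : Type u} [PartialGroup L] {M : PreLocality p L}

section Morphisms

variable {P Q R : M.TL}

theorem iota_comp_val (h : P.grp ≤ Q.grp) (φ : Q ⟶ R) : (iota P Q h ≫ φ).1 = φ.1 :=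
  prod_unit_left _

theorem comp_iota_val (φ : P ⟶ Q) (h : Q.grp ≤ R.grp) : (φ ≫ iota Q R h).1 = φ.1 :=
  prod_unit_right _

theorem conjTo_rhoHom (φ : P ⟶ Q) (x : P.grp) :
    ConjTo φ.1 ((x : M.S) : L) ((rhoHom φ x : M.S) : L) :=
  M.conjHom_spec φ.1 φ.2 x

theorem rhoHom_apply_eq {φ : P ⟶ Q} {x : P.grp} {y : M.S}
    (h : ConjTo φ.1 ((x : M.S) : L) (y : L)) : (rhoHom φ x : M.S) = y :=
  Subtype.ext ((conjTo_rhoHom φ x).eq h)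

/-- The isomorphism `P ⟶ P ^ g` given by `g`. -/
def isoOfConjEq {g : L} (h : ConjEq P.grp g Q.grp) : P ≅ Q where
  hom := ⟨g, h.1⟩
  inv := ⟨g⁻¹, h.symm.1⟩
  hom_inv_id := Subtype.ext (mul_inv_unit g)
  inv_hom_id := Subtype.ext (inv_mul_unit g)

theorem inv_val (φ : P ≅ Q) : φ.inv.1 = φ.hom.1⁻¹ :=
  eq_inv_of_mul (M.mul_mem_D Q.mem φ.inv.2 φ.hom.2) (congrArg Subtype.val φ.inv_hom_id)

theorem conjEq_of_iso (φ : P ≅ Q) : ConjEq P.grp φ.hom.1 Q.grp :=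
  conjEq_iff_transp.2 ⟨φ.hom.2, inv_val φ ▸ φ.inv.2⟩

/-- The image `P ^ φ` of a morphism `φ : P ⟶ Q`, as an object. -/
noncomputable def imageObj (φ : P ⟶ Q) : M.TL := ⟨M.image φ.1 φ.2, M.image_mem P.mem φ.1 φ.2⟩

theorem imageObj_le (φ : P ⟶ Q) : (imageObj φ).grp ≤ Q.grp := M.image_le φ.1 φ.2

theorem conjEq_imageObj (φ : P ⟶ Q) : ConjEq P.grp φ.1 (imageObj φ).grp := M.conjEq_image φ.1 φ.2

theorem isoOfConjEq_hom_comp_iota {φ : P ⟶ Q} (h : ConjEq P.grp φ.1 R.grp) (hR : R.grp ≤ Q.grp) :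
    (isoOfConjEq h).hom ≫ iota R Q hR = φ :=
  Subtype.ext (comp_iota_val _ hR)

theorem mono_iota (h : P.grp ≤ Q.grp) : Mono (iota P Q h) :=
  ⟨fun a b hab => Subtype.ext <| by
    simpa only [comp_iota_val] using congrArg Subtype.val hab⟩

theorem epi_iota (h : P.grp ≤ Q.grp) : Epi (iota P Q h) :=
  ⟨fun a b hab => Subtype.ext <| by
    simpa only [iota_comp_val] using congrArg Subtype.val hab⟩

instance (φ : P ⟶ Q) : Mono φ :=
  have := mono_iota (imageObj_le φ)
  isoOfConjEq_hom_comp_iota (conjEq_imageObj φ) (imageObj_le φ) ▸ mono_comp _ _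

instance (φ : P ⟶ Q) : Epi φ :=
  have := epi_iota (imageObj_le φ)
  isoOfConjEq_hom_comp_iota (conjEq_imageObj φ) (imageObj_le φ) ▸ epi_comp _ _

theorem epsElt_comp (φ : P ⟶ Q) (x : P.grp) : epsElt P x ≫ φ = φ ≫ epsElt Q (rhoHom φ x) :=
  Subtype.ext (conjTo_rhoHom φ x).prod_eq

theorem epsHom_injective (P Q : M.TL) : Function.Injective (epsHom P Q) := fun _ _ h =>
  Subtype.ext (Subtype.ext (congrArg (fun φ : P ⟶ Q => φ.1) h))

theorem rhoHom_epsHom (s : GTransp P.grp Q.grp) (x : P.grp) :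
    (rhoHom (epsHom P Q s) x : M.S) = (s : M.S)⁻¹ * x * s :=
  rhoHom_apply_eq (M.S.conjTo_coe s x)

end Morphisms

section Kernel

variable {P Q : M.TL}

theorem mem_kerRho_iff_map {α : Aut P} : α ∈ kerRho P ↔ M.rho.map α.hom = 𝟙 _ := by
  rw [kerRho, MonoidHom.mem_ker]
  exact ⟨fun h => congrArg Iso.hom h, fun h => Iso.ext h⟩

theorem mem_kerRho {α : Aut P} : α ∈ kerRho P ↔ α.hom.1 ∈ M.centralizer P.grp := by
  rw [mem_kerRho_iff_map]
  refine ⟨fun h x hx => ?_, fun h => Subtype.ext (MonoidHom.ext fun x => Subtype.ext ?_)⟩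
  · have hid : rhoHom α.hom = MonoidHom.id P.grp := congrArg Subtype.val h
    have hconj := conjTo_rhoHom α.hom ⟨x, hx⟩
    rwa [hid] at hconj
  · exact rhoHom_apply_eq (h x x.2)

theorem eq_one_of_hom_comp_eq {α : Aut P} {φ : P ⟶ Q} (h : α.hom ≫ φ = φ) : α = 1 :=
  Iso.ext ((cancel_mono φ).1 (h.trans (Category.id_comp φ).symm))

theorem eq_one_of_comp_hom_eq {β : Aut Q} {φ : P ⟶ Q} (h : φ ≫ β.hom = φ) : β = 1 :=
  Iso.ext ((cancel_epi φ).1 (h.trans (Category.comp_id φ).symm))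

/-- If `c_φ = c_ψ` then `φ` and `ψ` have the same image, and `α` is `ψ` followed by the inverse of
`φ` on it. -/
theorem exists_mem_kerRho_of_rhoHom_eq {φ ψ : P ⟶ Q} (h : rhoHom φ = rhoHom ψ) :
    ∃ α ∈ kerRho P, α.hom ≫ φ = ψ := by
  have hφ := conjEq_imageObj φ
  have himage : imageObj ψ = imageObj φ := by
    have : M.image ψ.1 ψ.2 = M.image φ.1 φ.2 :=
      congrArg (fun f : P.grp →* Q.grp => f.range.map Q.grp.subtype) h.symm
    simp only [imageObj, this]
  have hψ : ConjEq P.grp ψ.1 (imageObj φ).grp := himage ▸ conjEq_imageObj ψ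
  refine ⟨isoOfConjEq hψ ≪≫ (isoOfConjEq hφ).symm, mem_kerRho.2 fun x hx => ?_, ?_⟩
  · exact M.conjTo_comp P.mem hψ.1 hφ.symm.1 hx (conjTo_rhoHom ψ ⟨x, hx⟩)
      (h ▸ (conjTo_rhoHom φ ⟨x, hx⟩).symm)
  · have hinv : (isoOfConjEq hφ).inv ≫ φ = iota (imageObj φ) Q (imageObj_le φ) :=
      (Iso.inv_comp_eq _).2 (isoOfConjEq_hom_comp_iota hφ (imageObj_le φ)).symm
    rw [Iso.trans_hom, Iso.symm_hom, Category.assoc, hinv, isoOfConjEq_hom_comp_iota]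

theorem rhoHom_hom_comp {α : Aut P} (hα : α ∈ kerRho P) (φ : P ⟶ Q) :
    rhoHom (α.hom ≫ φ) = rhoHom φ := by
  rw [rhoHom, Functor.map_comp, mem_kerRho_iff_map.1 hα, Category.id_comp, rhoHom]

theorem rhoHom_eq_iff {φ ψ : P ⟶ Q} :
    rhoHom φ = rhoHom ψ ↔ ∃ α ∈ kerRho P, α.hom ≫ φ = ψ := by
  refine ⟨exists_mem_kerRho_of_rhoHom_eq, ?_⟩
  rintro ⟨α, hα, rfl⟩
  exact (rhoHom_hom_comp hα φ).symm

end Kernel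

section Automorphisms

variable (P : M.TL)

/-- The bijection between `N_L(P)` and the automorphisms of `P` in the transporter category. -/
def autEquiv : M.normalizer P.grp P.mem ≃ Aut P where
  toFun g := isoOfConjEq g.2
  invFun α := ⟨α.hom.1, conjEq_of_iso α⟩

theorem autEquiv_mul (g h : M.normalizer P.grp P.mem) :
    autEquiv P (g * h) = autEquiv P g ≪≫ autEquiv P h := Iso.ext rfl

theorem centralizer_subset_normalizer :
    M.centralizer P.grp ⊆ {g | g ∈ M.normalizer P.grp P.mem} := fun _ hg =>
  ⟨fun x hx => ⟨x, hx, hg x hx⟩, fun x hx => ⟨x, hx, hg x hx⟩⟩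

/-- The isomorphism `N_L(P) ≃* Aut_T(P)`. Multiplication in `Aut P` is composition in the order
opposite to that of `L`, whence the inverse. -/
def normalizerMulEquivAut : M.normalizer P.grp P.mem ≃* Aut P where
  toEquiv := (autEquiv P).trans (Equiv.inv _)
  map_mul' g h := (congrArg (·⁻¹) (autEquiv_mul P g h)).trans <|
    mul_inv_rev (autEquiv P h) (autEquiv P g)

theorem mem_epsImage {P : M.TL} {α : Aut P} : α ∈ epsImage P ↔ α.hom.1 ∈ M.S := by
  refine ⟨?_, fun h => ?_⟩
  · rintro ⟨β, rfl⟩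
    exact β.hom.1.2
  · let s : M.S := ⟨α.hom.1, h⟩
    have hs : s ∈ Subgroup.normalizer (P.grp : Set M.S) := conjEq_coe_iff.1 (conjEq_of_iso α)
    let β : Aut (⟨P.grp, P.mem⟩ : M.TS) :=
      { hom := ⟨s, fun x => (Subgroup.mem_normalizer_iff''.1 hs x).1⟩
        inv := ⟨s⁻¹, fun x => (Subgroup.mem_normalizer_iff''.1 (inv_mem hs) x).1⟩
        hom_inv_id := Subtype.ext (mul_inv_cancel s)
        inv_hom_id := Subtype.ext (inv_mul_cancel s) }
    exact ⟨β, Iso.ext rfl⟩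

theorem map_subgroupOf_normalizer :
    (M.S.subgroupOf (M.normalizer P.grp P.mem)).map (normalizerMulEquivAut P).toMonoidHom =
      epsImage P := by
  ext α
  rw [Subgroup.mem_map_equiv, ← inv_mem_iff (H := epsImage P), mem_epsImage]
  rfl

end Automorphisms

section Extension

theorem conjTo_of_inv_comp_comp {P Q : M.TL} {φ : P ≅ Q} {s : GTransp P.grp P.grp}
    {t : GTransp Q.grp Q.grp} (hs : (s : M.S) ∈ Subgroup.normalizer (P.grp : Set M.S))
    (h : φ.inv ≫ epsHom P P s ≫ φ.hom = epsHom Q Q t) :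
    ConjTo φ.hom.1 ((s : M.S) : L) ((t : M.S) : L) := by
  obtain ⟨hD, -⟩ := M.conjTo_of_normalizes P.mem (conjEq_of_iso φ) (conjEq_coe_iff.2 hs)
  have hprod : prod [φ.inv.1, prod [((s : M.S) : L), φ.hom.1]] = ((t : M.S) : L) :=
    congrArg Subtype.val h
  rw [inv_val] at hprod
  exact ⟨hD, (contract_prod [φ.hom.1⁻¹] [((s : M.S) : L), φ.hom.1] [] hD).trans hprod⟩

theorem exists_extension {P Q : M.TL} (φ : P ≅ Q) {P₁ Q₁ : Subgroup M.S} (hP : P.grp ≤ P₁)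
    (hQ : Q.grp ≤ Q₁) (hP₁ : P₁ ≤ Subgroup.normalizer (P.grp : Set M.S))
    (h : ∀ s : GTransp P.grp P.grp, (s : M.S) ∈ P₁ → ∃ t : GTransp Q.grp Q.grp, (t : M.S) ∈ Q₁ ∧
      φ.inv ≫ epsHom P P s ≫ φ.hom = epsHom Q Q t) :
    ∃ (hP₁ : P₁ ∈ M.Δ) (hQ₁ : Q₁ ∈ M.Δ) (φ₁ : (⟨P₁, hP₁⟩ : M.TL) ⟶ ⟨Q₁, hQ₁⟩),
      iota P ⟨P₁, hP₁⟩ hP ≫ φ₁ = φ.hom ≫ iota Q ⟨Q₁, hQ₁⟩ hQ := by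
  have hT : φ.hom.1 ∈ Transp P₁ Q₁ := by
    intro x hx
    have hxN := hP₁ hx
    obtain ⟨t, ht, hxt⟩ := h ⟨x, fun y => (Subgroup.mem_normalizer_iff''.1 hxN y).1⟩ hx
    exact ⟨t, ht, conjTo_of_inv_comp_comp hxN hxt⟩
  exact ⟨M.mem_of_le P.mem hP, M.mem_of_le Q.mem hQ, ⟨φ.hom.1, hT⟩,
    Subtype.ext ((prod_unit_left _).trans (prod_unit_right _).symm)⟩

theorem exists_iSup_extension {ι : Type*} [Nonempty ι] (P : ι → M.TL) {R : M.TL}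
    (ψ : ∀ i, P i ⟶ R) (hψ : ∀ i j, (ψ i).1 = (ψ j).1) :
    ∃ U : M.TL, U.grp = ⨆ i, (P i).grp ∧
      ∃ (hU : ∀ i, (P i).grp ≤ U.grp) (χ : U ⟶ R), ∀ i, ψ i = iota (P i) U (hU i) ≫ χ := by
  obtain ⟨i₀⟩ := ‹Nonempty ι›
  have hT : (ψ i₀).1 ∈ Transp (⨆ i, (P i).grp) R.grp :=
    M.mem_transp_iff_le_conjComap.2 <| iSup_le fun i =>
      M.mem_transp_iff_le_conjComap.1 (hψ i i₀ ▸ (ψ i).2)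
  exact ⟨⟨⨆ i, (P i).grp, M.mem_of_le (P i₀).mem (le_iSup (fun i => (P i).grp) i₀)⟩, rfl,
    le_iSup fun i => (P i).grp, ⟨(ψ i₀).1, hT⟩,
    fun i => Subtype.ext ((hψ i i₀).trans (prod_unit_left _).symm)⟩

theorem exists_iUnion_extension (P : ℕ → M.TL) (hle : ∀ i, (P i).grp ≤ (P (i + 1)).grp) {R : M.TL}
    (ψ : ∀ i, P i ⟶ R) (hψ : ∀ i, ψ i = iota (P i) (P (i + 1)) (hle i) ≫ ψ (i + 1)) :
    ∃ U : M.TL, (U.grp : Set M.S) = ⋃ i, ((P i).grp : Set M.S) ∧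
      ∃ (hU : ∀ i, (P i).grp ≤ U.grp) (χ : U ⟶ R), ∀ i, ψ i = iota (P i) U (hU i) ≫ χ := by
  have hsucc : ∀ i, (ψ (i + 1)).1 = (ψ i).1 := fun i => by rw [hψ i, iota_comp_val]
  have hzero : ∀ i, (ψ i).1 = (ψ 0).1 := Nat.rec rfl fun i ih => (hsucc i).trans ih
  obtain ⟨U, hU, hext⟩ := exists_iSup_extension P ψ fun i j => (hzero i).trans (hzero j).symm
  refine ⟨U, hU ▸ Subgroup.coe_iSup_of_directed ?_, hext⟩
  exact (monotone_nat_of_le_succ (f := fun i => (P i).grp) hle).directed_le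

end Extension

section Fusion

variable {P Q R : Subgroup M.S} {φ : P →* Q} {ψ : Q →* R} {X : Subgroup P} {g : L}

theorem isConj_of_conjEq (hP : P ∈ M.Δ) (h : ConjEq P g Q) : M.fusion.IsConj P Q := by
  refine ⟨MulEquiv.ofBijective (M.conjHom g h.1) ⟨M.conjHom_injective g h.1, fun y => ?_⟩,
    .of _ ⟨hP, M.mem_Δ_of_conjEq h hP, g, h.1, rfl⟩⟩
  obtain ⟨x, hx, hxy⟩ := h.2 y y.2
  exact ⟨⟨x, hx⟩, Subtype.ext (Subtype.ext ((M.conjHom_spec g h.1 ⟨x, hx⟩).eq hxy))⟩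

/-- The homomorphism `φ` is conjugation by `g` on the subgroup `X` of its source. -/
def IsConjOn (φ : P →* Q) (X : Subgroup P) (g : L) : Prop :=
  ∀ x ∈ X, ConjTo g ((x : M.S) : L) ((φ x : M.S) : L)

/-- The homomorphism `φ` is conjugation by some element of `L` on each subgroup of its source which
is an object or whose image is an object. The condition on the image makes the notion stable under
inverses. -/
def IsLocallyConj (φ : P →* Q) : Prop :=
  ∀ X : Subgroup P, X.map P.subtype ∈ M.Δ ∨ (X.map φ).map Q.subtype ∈ M.Δ → ∃ g, IsConjOn φ X g

theorem IsConjOn.conjEq (h : IsConjOn φ X g) :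
    ConjEq (X.map P.subtype) g ((X.map φ).map Q.subtype) := by
  constructor
  · rintro _ ⟨x, hx, rfl⟩
    exact ⟨_, ⟨_, ⟨x, hx, rfl⟩, rfl⟩, h x hx⟩
  · rintro _ ⟨_, ⟨x, hx, rfl⟩, rfl⟩
    exact ⟨_, ⟨x, hx, rfl⟩, h x hx⟩

theorem IsConjOn.mem_Δ_iff (h : IsConjOn φ X g) :
    X.map P.subtype ∈ M.Δ ↔ (X.map φ).map Q.subtype ∈ M.Δ :=
  ⟨M.mem_Δ_of_conjEq h.conjEq, M.mem_Δ_of_conjEq h.conjEq.symm⟩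

theorem IsConjOn.comp {h : L} (hX : X.map P.subtype ∈ M.Δ) (hφ : IsConjOn φ X g)
    (hψ : IsConjOn ψ (X.map φ) h) : IsConjOn (ψ.comp φ) X (prod [g, h]) := fun x hx =>
  M.conjTo_comp hX hφ.conjEq.1 hψ.conjEq.1 ⟨x, hx, rfl⟩ (hφ x hx) (hψ _ ⟨x, hx, rfl⟩)

theorem IsLocallyConj.comp (hφ : IsLocallyConj φ) (hψ : IsLocallyConj ψ) :
    IsLocallyConj (ψ.comp φ) := by
  intro X hX
  rw [← Subgroup.map_map] at hX
  rcases hX with hX | hX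
  · obtain ⟨g, hg⟩ := hφ X (.inl hX)
    obtain ⟨h, hh⟩ := hψ (X.map φ) (.inl (hg.mem_Δ_iff.1 hX))
    exact ⟨_, hg.comp hX hh⟩
  · obtain ⟨h, hh⟩ := hψ (X.map φ) (.inr hX)
    have hXφ := hh.mem_Δ_iff.2 hX
    obtain ⟨g, hg⟩ := hφ X (.inr hXφ)
    exact ⟨_, hg.comp (hg.mem_Δ_iff.2 hXφ) hh⟩

theorem IsLocallyConj.symm {e : P ≃* Q} (he : IsLocallyConj e.toMonoidHom) :
    IsLocallyConj e.symm.toMonoidHom := by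
  intro X hX
  have hXe : (X.map e.symm.toMonoidHom).map e.toMonoidHom = X := by
    rw [Subgroup.map_map]
    convert X.map_id
    exact MonoidHom.ext e.apply_symm_apply
  obtain ⟨g, hg⟩ := he (X.map e.symm.toMonoidHom) (by rw [hXe]; exact hX.symm)
  refine ⟨g⁻¹, fun x hx => ConjTo.symm ?_⟩
  simpa using hg (e.symm x) ⟨x, hx, rfl⟩

theorem isLocallyConj_of_isHom (hφ : M.fusion.IsHom φ) : IsLocallyConj φ := by
  change FusionSystem.Generated _ P Q φ at hφ
  induction hφ with
  | of φ h =>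
    obtain ⟨-, -, g, hg, rfl⟩ := h
    exact fun X _ => ⟨g, fun x _ => M.conjHom_spec g hg x⟩
  | conj s φ h => exact fun X _ => ⟨s, fun x _ => h x ▸ M.S.conjTo_coe s x⟩
  | comp φ ψ _ _ hφ hψ => exact hφ.comp hψ
  | @codRestrict P Q R φ ψ _ hφψ hφ =>
    intro X hX
    have himage : (X.map ψ).map R.subtype = (X.map φ).map Q.subtype := by
      rw [Subgroup.map_map, Subgroup.map_map]
      exact congrArg X.map (MonoidHom.ext hφψ)
    obtain ⟨g, hg⟩ := hφ X (himage ▸ hX)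
    exact ⟨g, fun x hx => hφψ x ▸ hg x hx⟩
  | symm e _ he => exact he.symm

theorem exists_rhoHom_eq {P Q : M.TL} (ψ : P.grp →* Q.grp) (hψ : M.fusion.IsHom ψ) :
    ∃ φ : P ⟶ Q, rhoHom φ = ψ := by
  have hP : (⊤ : Subgroup P.grp).map P.grp.subtype ∈ M.Δ := by
    rw [← MonoidHom.range_eq_map, Subgroup.range_subtype]
    exact P.mem
  obtain ⟨g, hg⟩ := isLocallyConj_of_isHom hψ ⊤ (.inl hP)
  let φ : P ⟶ Q := ⟨g, fun x hx => ⟨_, (ψ ⟨x, hx⟩).2, hg ⟨x, hx⟩ trivial⟩⟩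
  exact ⟨φ, MonoidHom.ext fun x => Subtype.ext (rhoHom_apply_eq (hg x trivial))⟩

end Fusion

end PreLocality

namespace Locality

open CategoryTheory PreLocality

variable {p : ℕ} [Fact p.Prime] {L : Type u} [PartialGroup L] (M : Locality p L)
  (htoral : ∀ (P : Subgroup M.S) (hP : P ∈ M.Δ), IsVirtuallyToral p (M.normalizer P hP))

include htoral

theorem isIso_of_endomorphism {P : M.TL} (φ : P ⟶ P) : IsIso φ :=
  (isoOfConjEq (M.conjEq_of_transp htoral P.mem φ.2)).isIso_hom

theorem exists_isConj_sylow_epsImage (R : M.TL) :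
    ∃ P : M.TL, M.fusion.IsConj R.grp P.grp ∧
      IsPGroup p (epsImage P) ∧ (epsImage P).FiniteIndex ∧ (epsImage P).index.Coprime p := by
  obtain ⟨g, Q, hQ, hg, T, hT⟩ := M.exists_conjEq_sylow htoral R.mem
  let P : M.TL := ⟨Q, hQ⟩
  have hfin := (htoral Q hQ).finiteIndex_sylow T
  have hmap : (T : Subgroup (M.normalizer Q hQ)).map (normalizerMulEquivAut P).toMonoidHom =
      epsImage P := by
    rw [hT]
    exact map_subgroupOf_normalizer P
  have hindex : (epsImage P).index = (T : Subgroup (M.normalizer Q hQ)).index := by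
    rw [← hmap]
    exact Subgroup.index_map_equiv _ (normalizerMulEquivAut P)
  refine ⟨P, isConj_of_conjEq R.mem hg, ?_, ⟨?_⟩, ?_⟩
  · rw [← hmap]
    exact T.isPGroup'.map _
  · rw [hindex]
    exact hfin.index_ne_zero
  · rw [hindex]
    exact ((Nat.Prime.coprime_iff_not_dvd Fact.out).2 T.not_dvd_index).symm

end Locality

open CategoryTheory PreLocality in
theorem propositionA8_general {p : ℕ} [Fact p.Prime] {L : Type u} [PartialGroup L]
    (M : Locality p L)
    (htoral : ∀ (P : Subgroup M.S) (hP : P ∈ M.Δ), IsVirtuallyToral p (M.normalizer P hP)) :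
    (∀ P : M.TL, (∀ φ : P ⟶ P, IsIso φ) ∧
      ∃ e : M.normalizer P.grp P.mem ≃ Aut P,
        (∀ g, (e g).hom.1 = (g : L)) ∧
        (∀ g h, e (g * h) = e g ≪≫ e h) ∧
        (∀ g, e g ∈ kerRho P ↔ (g : L) ∈ M.centralizer P.grp) ∧
        (∀ g ∈ M.centralizer P.grp, g ∈ M.normalizer P.grp P.mem)) ∧
    ((∀ P : M.TS, (M.eps.obj P).grp = P.grp) ∧ (∀ P : M.TL, (M.rho.obj P).grp = P.grp)) ∧
    (∀ P Q : M.TL,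
      (∀ α ∈ kerRho P, ∀ φ : P ⟶ Q, α.hom ≫ φ = φ → α = 1) ∧
      (∀ ψ : P.grp →* Q.grp, M.fusion.IsHom ψ → ∃ φ : P ⟶ Q, rhoHom φ = ψ) ∧
      (∀ φ ψ : P ⟶ Q, rhoHom φ = rhoHom ψ ↔ ∃ α ∈ kerRho P, α.hom ≫ φ = ψ) ∧
      (∀ β ∈ kerRho Q, ∀ φ : P ⟶ Q, φ ≫ β.hom = φ → β = 1)) ∧
    (∀ P Q : M.TL, Function.Injective (epsHom P Q) ∧
      ∀ (s : GTransp P.grp Q.grp) (x : P.grp),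
        (rhoHom (epsHom P Q s) x : M.S) = (s : M.S)⁻¹ * x * s) ∧
    (∀ (P Q : M.TL) (φ : P ⟶ Q) (x : P.grp), epsElt P x ≫ φ = φ ≫ epsElt Q (rhoHom φ x)) ∧
    (∀ R : M.TL, ∃ P : M.TL, M.fusion.IsConj R.grp P.grp ∧
      IsPGroup p (epsImage P) ∧ (epsImage P).FiniteIndex ∧ (epsImage P).index.Coprime p) ∧
    (∀ (P Q : M.TL) (φ : P ≅ Q) (P₁ Q₁ : Subgroup M.S) (hP : P.grp ≤ P₁) (hQ : Q.grp ≤ Q₁),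
      (P.grp.subgroupOf P₁).Normal → (Q.grp.subgroupOf Q₁).Normal →
      (∀ s : GTransp P.grp P.grp, (s : M.S) ∈ P₁ → ∃ t : GTransp Q.grp Q.grp, (t : M.S) ∈ Q₁ ∧
        φ.inv ≫ epsHom P P s ≫ φ.hom = epsHom Q Q t) →
      ∃ (hP₁ : P₁ ∈ M.Δ) (hQ₁ : Q₁ ∈ M.Δ) (φ₁ : (⟨P₁, hP₁⟩ : M.TL) ⟶ ⟨Q₁, hQ₁⟩),
        iota P ⟨P₁, hP₁⟩ hP ≫ φ₁ = φ.hom ≫ iota Q ⟨Q₁, hQ₁⟩ hQ) ∧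
    (∀ (P : ℕ → M.TL) (hle : ∀ i, (P i).grp ≤ (P (i + 1)).grp) (ψ : ∀ i, P i ⟶ M.topObj),
      (∀ i, ψ i = iota (P i) (P (i + 1)) (hle i) ≫ ψ (i + 1)) →
      ∃ U : M.TL, (U.grp : Set M.S) = ⋃ i, ((P i).grp : Set M.S) ∧
        ∃ (hU : ∀ i, (P i).grp ≤ U.grp) (χ : U ⟶ M.topObj),
          ∀ i, ψ i = iota (P i) U (hU i) ≫ χ) := by
  refine ⟨fun P => ⟨fun φ => ?endomorphism, autEquiv P, fun _ => rfl, autEquiv_mul P,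
      fun _ => mem_kerRho, fun _ hg => centralizer_subset_normalizer P hg⟩,
    ⟨fun _ => rfl, fun _ => rfl⟩, fun P Q => ?A2, fun P Q => ?B, fun P Q => ?C, ?I, ?II, ?III⟩
  case endomorphism => exact M.isIso_of_endomorphism htoral φ
  case A2 =>
    exact ⟨fun _ _ _ => eq_one_of_hom_comp_eq, exists_rhoHom_eq, fun _ _ => rhoHom_eq_iff,
      fun _ _ _ => eq_one_of_comp_hom_eq⟩
  case B => exact ⟨epsHom_injective P Q, rhoHom_epsHom⟩
  case C => exact epsElt_comp
  case I => exact M.exists_isConj_sylow_epsImage htoral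
  case II =>
    intro P Q φ P₁ Q₁ hP hQ hPn _ h
    exact exists_extension φ hP hQ ((Subgroup.normal_subgroupOf_iff_le_normalizer hP).1 hPn) h
  case III => exact fun P hle => exists_iUnion_extension P hle

open CategoryTheory PreLocality in
theorem propositionA8 {p : ℕ} [Fact p.Prime] {L : Type u} [PartialGroup L] (M : Locality p L)
    (hM : M.IsCompact) :
    -- `Mor_T(P, P) = Aut_T(P)` is identified with `N_L(P)`, and `Ker(ρ_P)` with `C_L(P)`
    (∀ P : M.TL, (∀ φ : P ⟶ P, IsIso φ) ∧
      ∃ e : M.normalizer P.grp P.mem ≃ Aut P,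
        (∀ g, (e g).hom.1 = (g : L)) ∧
        (∀ g h, e (g * h) = e g ≪≫ e h) ∧
        (∀ g, e g ∈ kerRho P ↔ (g : L) ∈ M.centralizer P.grp) ∧
        (∀ g ∈ M.centralizer P.grp, g ∈ M.normalizer P.grp P.mem)) ∧
    -- (A1)
    ((∀ P : M.TS, (M.eps.obj P).grp = P.grp) ∧ (∀ P : M.TL, (M.rho.obj P).grp = P.grp)) ∧
    -- (A2)
    (∀ P Q : M.TL,
      (∀ α ∈ kerRho P, ∀ φ : P ⟶ Q, α.hom ≫ φ = φ → α = 1) ∧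
      (∀ ψ : P.grp →* Q.grp, M.fusion.IsHom ψ → ∃ φ : P ⟶ Q, rhoHom φ = ψ) ∧
      (∀ φ ψ : P ⟶ Q, rhoHom φ = rhoHom ψ ↔ ∃ α ∈ kerRho P, α.hom ≫ φ = ψ) ∧
      (∀ β ∈ kerRho Q, ∀ φ : P ⟶ Q, φ ≫ β.hom = φ → β = 1)) ∧
    -- (B)
    (∀ P Q : M.TL, Function.Injective (epsHom P Q) ∧
      ∀ (s : GTransp P.grp Q.grp) (x : P.grp),
        (rhoHom (epsHom P Q s) x : M.S) = (s : M.S)⁻¹ * x * s) ∧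
    -- (C)
    (∀ (P Q : M.TL) (φ : P ⟶ Q) (x : P.grp), epsElt P x ≫ φ = φ ≫ epsElt Q (rhoHom φ x)) ∧
    -- (I)
    (∀ R : M.TL, ∃ P : M.TL, M.fusion.IsConj R.grp P.grp ∧
      IsPGroup p (epsImage P) ∧ (epsImage P).FiniteIndex ∧ (epsImage P).index.Coprime p) ∧
    -- (II)
    (∀ (P Q : M.TL) (φ : P ≅ Q) (P₁ Q₁ : Subgroup M.S) (hP : P.grp ≤ P₁) (hQ : Q.grp ≤ Q₁),
      (P.grp.subgroupOf P₁).Normal → (Q.grp.subgroupOf Q₁).Normal →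
      (∀ s : GTransp P.grp P.grp, (s : M.S) ∈ P₁ → ∃ t : GTransp Q.grp Q.grp, (t : M.S) ∈ Q₁ ∧
        φ.inv ≫ epsHom P P s ≫ φ.hom = epsHom Q Q t) →
      ∃ (hP₁ : P₁ ∈ M.Δ) (hQ₁ : Q₁ ∈ M.Δ) (φ₁ : (⟨P₁, hP₁⟩ : M.TL) ⟶ ⟨Q₁, hQ₁⟩),
        iota P ⟨P₁, hP₁⟩ hP ≫ φ₁ = φ.hom ≫ iota Q ⟨Q₁, hQ₁⟩ hQ) ∧
    -- (III)
    (∀ (P : ℕ → M.TL) (hle : ∀ i, (P i).grp ≤ (P (i + 1)).grp) (ψ : ∀ i, P i ⟶ M.topObj),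
      (∀ i, ψ i = iota (P i) (P (i + 1)) (hle i) ≫ ψ (i + 1)) →
      ∃ U : M.TL, (U.grp : Set M.S) = ⋃ i, ((P i).grp : Set M.S) ∧
        ∃ (hU : ∀ i, (P i).grp ≤ U.grp) (χ : U ⟶ M.topObj),
          ∀ i, ψ i = iota (P i) U (hU i) ≫ χ) :=
  propositionA8_general M hM.toral
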